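/- \textbf{Model.} Let $V$ be a finite vertex set and let $M^{(1)},\dots,M^{(d)}$ be matchings on $V$. A matching is identified with the matrix that has entries $1/2$ at $(u,u),(v,v),(u,v),(v,u)$ for each of its edges $\{u,v\}$, entry $1$ at $(u,u)$ for each unmatched $u$, and $0$ elsewhere. The round matrix is $\mathbf M=M^{(1)}\cdots M^{(d)}$. In one round the matchings are applied in the order $M^{(1)},\dots,M^{(d)}$ to an integer load vector: for each edge $\{u,v\}$ with loads $a,b$, one endpoint, chosen by an independent fair coin, receives $\lceil (a+b)/2\rceil$ tokens and the other receives $\lfloor (a+b)/2\rfloor$. Let $x^{(t)}$ be the load vector after $t$ rounds and $\operatorname{disc}(x)=\max_u x_u-\min_u x_u$. In the average case the initial loads $x^{(0)}_u$, $u\in V$, are independent with a common distribution $D$ on $\{0,1,2,\dots\}$ with mean $\mu$ and finite variance $\sigma^2$ that is exponentially concentrated with constants $B,\kappa>0$, i.e. $\Pr_{X\sim D}[|X-\mu|\ge\delta\sigma]\le B e^{-\kappa\delta}$ for all $\delta>0$. \textbf{Topologies.} For even $m\ge 4$, the odd--even circuit on the cycle with vertex set $\{0,\dots,m-1\}$ has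 $d=2$; $M^{(1)}$ consists of the edges $\{j,j+1 \bmod m\}$ with $j$ odd and $M^{(2)}$ of those with $j$ even. For $r\ge 1$, the circuit on the $r$-dimensional torus with vertex set $\{0,\dots,m-1\}^r$ has $d=2r$: for each dimension in turn, the two odd--even matchings along that dimension. Put $n=m^r$, with $r=1$ for the cycle. \textbf{Theorem.} The following hold for the cycle (with $r=1$) and, for every fixed $r\ge 1$, for the $r$-dimensional torus. 1. There is a constant $C$ depending only on $r$ such that $\|\mathbf M^t_{\cdot,u}-\tfrac1n\|_2^2\le C t^{-r/2}$ for all even $m\ge4$, all $t\ge1$ and all vertices $u$. For every $A>0$ there is $c>0$ depending only on $r,A$ such that $\|\mathbf M^t_{\cdot,u}-\tfrac1n\|_2^2\ge c\, t^{-r/2}$ for all even $m\ge 6$, all $1\le t\le A m^2=A n^{2/r}$ and all vertices $u$. 2. There are constants $C,K$ depending only on $r,B,\kappa$ such that for all even $m\ge4$, all $D$ as above and all $t\ge1$, $$\Pr\Big[\operatorname{disc}(x^{(t)})\le C\big(t^{-r/4}\,\sigma\,(\log n)^{3/2}+\sqrt{\log n}\big)\Big]\ge 1-\frac Kn .$$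 3. For every $A>0$ there are constants $c,C>0$ and $t_0$ depending only on $r,B,\kappa,A$ such that for all even $m\ge4$, all $D$ as above and all $t$ with $\max(t_0,1)\le t\le A m^2=A n^{2/r}$, $$\Pr\Big[\operatorname{disc}(x^{(t)})\ge c\, t^{-r/4}\,\frac{\sigma}{\sqrt{\log\max(\sigma,2)}}-C\sqrt{\log n}\Big]\ge\frac1{16}.$$ -/

import Mathlib

open MeasureTheory ProbabilityTheory

noncomputable section

/-- A matching on the vertex set `V`, given by the involution that exchanges the endpoints of every
matching edge; `u` is unmatched iff `partner u = u`. -/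
structure Matching (V : Type*) where
  partner : V → V
  involutive : Function.Involutive partner

/-- The matching matrix: `1/2` at `(u,u)`, `(u,v)`, `(v,u)`, `(v,v)` for each matching edge `{u,v}`,
`1` at `(u,u)` for each unmatched `u`, and `0` elsewhere. -/
def Matching.matrix {V : Type*} [DecidableEq V] (M : Matching V) : Matrix V V ℝ :=
  Matrix.of fun u v =>
    if M.partner u = u then (if v = u then 1 else 0)
    else if v = u ∨ v = M.partner u then 1 / 2 else 0

/-- The round matrix `M⁽¹⁾ M⁽²⁾ ⋯ M⁽ᵈ⁾` of a balancing circuit, that is, of a sequence of `d` matchings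
that is applied periodically. -/
def roundMatrix {V : Type*} [Fintype V] [DecidableEq V] {d : ℕ} (M : Fin d → Matching V) :
    Matrix V V ℝ :=
  (List.ofFn fun s => (M s).matrix).prod

/-- A choice of one endpoint for every unordered pair of vertices. -/
abbrev EndpointChoice (V : Type*) : Type _ := (e : Sym2 V) → {v : V // v ∈ e}

instance endpointChoiceNonempty (V : Type*) : Nonempty (EndpointChoice V) :=
  ⟨fun e => ⟨(Quot.out e).1, Sym2.out_fst_mem e⟩⟩

instance endpointChoiceFintype (V : Type*) [Fintype V] [DecidableEq V] :
    Fintype (EndpointChoice V) :=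
  inferInstanceAs (Fintype ((e : Sym2 V) → {v : V // v ∈ e}))

/-- One matching step for indivisible tokens: for each matching edge `{u,v}`, the endpoint chosen by `o`
receives `⌈(x u + x v)/2⌉` tokens and the other endpoint receives `⌊(x u + x v)/2⌋` tokens. -/
def balance {V : Type*} [DecidableEq V] (M : Matching V) (x : V → ℤ) (o : EndpointChoice V) :
    V → ℤ := fun u =>
  if M.partner u = u then x u
  else if (o s(u, M.partner u) : V) = u then ⌈((x u + x (M.partner u) : ℤ) : ℚ) / 2⌉
  else ⌊((x u + x (M.partner u) : ℤ) : ℚ) / 2⌋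

/-- Random orientation: the endpoint receiving the rounded-up load is chosen uniformly at random,
independently for all matching edges. -/
def balanceLaw {V : Type*} [Fintype V] [DecidableEq V] (M : Matching V) (x : V → ℤ) :
    PMF (V → ℤ) :=
  (PMF.uniformOfFintype (EndpointChoice V)).map (balance M x)

/-- The law of the load vector after the first `s` matching steps of the periodic sequence
`M 0, …, M (d-1), M 0, …`, started from `x`, with fresh independent randomness in every step. -/
def stepLaw {V : Type*} [Fintype V] [DecidableEq V] {d : ℕ} [NeZero d] (M : Fin d → Matching V)
    (x : V → ℤ) : ℕ → PMF (V → ℤ)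
  | 0 => PMF.pure x
  | s + 1 => (stepLaw M x s).bind (balanceLaw (M (Fin.ofNat d s)))

/-- The law of the load vector after `t` rounds (`t * d` matching steps) in the average case: the initial
loads are independent with common distribution `D`. -/
def averageCaseLaw {V : Type*} [Fintype V] [DecidableEq V] {d : ℕ} [NeZero d]
    (M : Fin d → Matching V) (D : Measure ℕ) (t : ℕ) : Measure (V → ℤ) :=
  (Measure.pi fun _ : V => D).bind fun x => (stepLaw M (fun v => (x v : ℤ)) (t * d)).toMeasure

/-- The discrepancy: maximum load minus minimum load. -/
def disc {V : Type*} [Fintype V] [Nonempty V] (x : V → ℤ) : ℤ :=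
  Finset.univ.sup' Finset.univ_nonempty x - Finset.univ.inf' Finset.univ_nonempty x

/-- Expectation of a distribution on `ℕ`. -/
def distMean (D : Measure ℕ) : ℝ := ∫ k, (k : ℝ) ∂D

/-- Standard deviation of a distribution on `ℕ`. -/
def distStd (D : Measure ℕ) : ℝ := √(variance (fun k : ℕ => (k : ℝ)) D)

/-- `D` (with finite variance) is exponentially concentrated with constants `B` and `κ`. -/
structure IsExpConcentrated (D : Measure ℕ) (B κ : ℝ) : Prop where
  memLp_two : MemLp (fun k : ℕ => (k : ℝ)) 2 D
  tail : ∀ δ : ℝ, 0 < δ →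
    D.real {k : ℕ | δ * distStd D ≤ |(k : ℝ) - distMean D|} ≤ B * Real.exp (-κ * δ)

/-- In the matching of parity `q` on the cycle `0, 1, …, n-1`, the edges are `{j, j+1 mod n}` with
`j ≡ q` modulo 2. -/
def cyclePartner (n : ℕ) (q : Fin 2) (u : ZMod n) : ZMod n :=
  if u.val % 2 = q then u + 1 else u - 1

theorem cyclePartner_involutive (n : ℕ) [NeZero n] (hn : Even n) (q : Fin 2) :
    Function.Involutive (cyclePartner n q) := by
  have key : ∀ u : ZMod n, (u + 1).val % 2 = (u.val + 1) % 2 := by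
    intro u
    rcases Nat.lt_or_ge 1 n with h1 | h1
    · have : Fact (1 < n) := ⟨h1⟩
      rw [ZMod.val_add, ZMod.val_one, Nat.mod_mod_of_dvd _ hn.two_dvd]
    · have h0 := NeZero.ne n
      obtain ⟨k, hk⟩ := hn
      omega
  intro u
  have h1 := key u
  have h2 := key (u - 1)
  rw [sub_add_cancel] at h2
  have hq := q.isLt
  unfold cyclePartner
  by_cases h : u.val % 2 = q
  · have h3 : ¬ (u + 1).val % 2 = q := by omega
    simp [h, h3]
  · have h3 : (u - 1).val % 2 = q := by omega
    simp [h, h3]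

/-- The matching of parity `q` on the cycle of even length `n`. -/
def cycleMatching (n : ℕ) [NeZero n] (hn : Even n) (q : Fin 2) : Matching (ZMod n) :=
  ⟨cyclePartner n q, cyclePartner_involutive n hn q⟩

/-- The odd-even balancing circuit on the cycle of even length `n`: first the edges `{j, j+1 mod n}`
with `j` odd, then those with `j` even. -/
def cycleCircuit (n : ℕ) [NeZero n] (hn : Even n) : Fin 2 → Matching (ZMod n) :=
  ![cycleMatching n hn 1, cycleMatching n hn 0]

/-- The matching on `W ^ r` that matches along coordinate `i` according to `N`. -/
def Matching.along {W : Type*} {r : ℕ} (i : Fin r) (N : Matching W) : Matching (Fin r → W) where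
  partner u := Function.update u i (N.partner (u i))
  involutive u := by simp [N.involutive (u i)]

/-- The balancing circuit on the `r`-dimensional torus of even side length `m`: for each dimension in
turn, the two matchings of the odd-even circuit along that dimension (`2 r` matchings in total). -/
def torusCircuit (r m : ℕ) [NeZero m] (hm : Even m) : Fin (r * 2) → Matching (Fin r → ZMod m) :=
  fun s => (cycleCircuit m hm s.modNat).along s.divNat

end

/-! Pair the load vector after `t` rounds with a test vector `v`. Matching matrices are symmetric,
so each averaging step can be moved from the load onto `v`. The rounding errors of that step are
opposite at the two ends of an edge and independent across edges. Their exponential moment is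
bounded by the exponential of one quarter of the drop of `‖v‖²` under the matching matrix. These
drops telescope, so rounding costs at most a factor `exp (‖v‖² / 4)` however many rounds are made
(`tsum_stepLaw_exp_le`). For `v` the unit mass at `u` minus the uniform distribution, what remains
is a linear form in the independent initial loads, with coefficients the column `u` of the `t`-th
power of the round matrix minus `1/n`.

Hence everything is governed by the distance of the columns from uniform. For the upper bound,
exponential concentration makes the linear form sub-Gaussian for small parameters, and a Chernoff
bound with a union bound over vertices applies (`exists_averageCaseLaw_disc_le`). For the lower
bound, one vertex is enough: the linear form is of the order of its standard deviation with constant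
probability, by a fourth moment argument that needs no coefficient to dominate, and given the
initial loads rounding shifts it by only `O(√(log n))` (`exists_le_averageCaseLaw_disc`).

For the columns on the cycle, note that both ends of an edge carry the same averaged load right
after it is matched. Contracting these edges turns the divisible process into simple random walk, so
the squared norm of a column is a return probability, and the part beyond uniform is a sum of powers
of `|cos|` (`sum_roundMatrix_cycleCircuit_pow_sub_sq`). Comparison with a Gaussian sum gives
`t^(-1/2)` from above, and counting low frequencies gives it from below while `t = O(m²)`. On the
torus the round matrix is a Kronecker power, so squared column norms are `r`-th powers of those of
the cycle. Subtracting the uniform part then requires the faster decay of the cosine sum once `t`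
exceeds `m²` (`exists_torus_excess_le`). -/

namespace Matching

/-! ### Matching matrices as averaging operators. -/

variable {V : Type*} [Fintype V] [DecidableEq V]

theorem matrix_mulVec (M : Matching V) (v : V → ℝ) (u : V) :
    (M.matrix.mulVec v) u = (v u + v (M.partner u)) / 2 := by
  simp only [Matrix.mulVec, dotProduct, Matching.matrix, Matrix.of_apply]
  by_cases h : M.partner u = u
  · simp [h]
  · have : ∀ w, (if M.partner u = u then (if w = u then (1 : ℝ) else 0)
        else if w = u ∨ w = M.partner u then 1 / 2 else 0) * v w
        = (if w = u then v w / 2 else 0) + (if w = M.partner u then v w / 2 else 0) := by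
      intro w
      rw [if_neg h]
      by_cases h1 : w = u
      · subst h1
        simp [Ne.symm h]
        ring
      · by_cases h2 : w = M.partner u
        · simp [h2, h]
          ring
        · simp [h1, h2]
    simp_rw [this]
    rw [Finset.sum_add_distrib]
    simp
    ring

omit [DecidableEq V] in
theorem sum_comp_partner {A : Type*} [AddCommMonoid A] (M : Matching V) (f : V → A) :
    ∑ u, f (M.partner u) = ∑ u, f u :=
  Equiv.sum_comp (M.involutive.toPerm M.partner) f

theorem sum_matrix_mulVec (M : Matching V) (v : V → ℝ) :
    ∑ u, (M.matrix.mulVec v) u = ∑ u, v u := by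
  simp_rw [matrix_mulVec, ← Finset.sum_div, Finset.sum_add_distrib, M.sum_comp_partner v]
  ring

theorem matrix_mulVec_const (M : Matching V) (c : ℝ) :
    M.matrix.mulVec (fun _ => c) = fun _ => c := by
  ext u
  rw [matrix_mulVec]
  ring

/-- Self-adjointness of the averaging step: it transfers the step from the load vector to the test
vector. -/
theorem sum_mulVec_mul (M : Matching V) (x v : V → ℝ) :
    ∑ u, (x u + x (M.partner u)) / 2 * v u = ∑ u, x u * (M.matrix.mulVec v) u := by
  have h := M.sum_comp_partner fun u => x u * v (M.partner u)
  simp only [M.involutive _] at h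
  simp_rw [matrix_mulVec]
  calc ∑ u, (x u + x (M.partner u)) / 2 * v u
      = (∑ u, x u * v u + ∑ u, x (M.partner u) * v u) / 2 := by
        rw [← Finset.sum_add_distrib, Finset.sum_div]
        exact Finset.sum_congr rfl fun u _ => by ring
    _ = (∑ u, x u * v u + ∑ u, x u * v (M.partner u)) / 2 := by rw [h]
    _ = _ := by
        rw [← Finset.sum_add_distrib, Finset.sum_div]
        exact Finset.sum_congr rfl fun u _ => by ring

/-- Energy dissipation identity. Its right side is also what the rounding errors cost in
`sum_exp_edge_le`, which is why the costs telescope. -/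
theorem sum_sq_sub_sum_sq_mulVec (M : Matching V) (v : V → ℝ) :
    ∑ u, v u ^ 2 - ∑ u, (M.matrix.mulVec v) u ^ 2
      = ∑ u, ((v u - v (M.partner u)) / 2) ^ 2 := by
  have h := M.sum_comp_partner fun u => v u ^ 2
  simp_rw [matrix_mulVec]
  have : ∑ u, v u ^ 2 = ∑ u, (v u ^ 2 + v (M.partner u) ^ 2) / 2 := by
    rw [← Finset.sum_div, Finset.sum_add_distrib, h]
    ring
  rw [this, ← Finset.sum_sub_distrib]
  exact Finset.sum_congr rfl fun u _ => by ring

end Matching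

/-! ### Exponential moments of one randomized rounding step. -/

section OneStep

variable {V : Type*} [Fintype V] [DecidableEq V]

/-- Half the parity of the total load on the edge at `u`. -/
noncomputable def halfParity (M : Matching V) (x : V → ℤ) (u : V) : ℝ :=
  if (x u + x (M.partner u)) % 2 = 0 then 0 else 1 / 2

/-- The rounding error at `u` when `c` is the endpoint that receives the rounded-up load. -/
noncomputable def roundingError (M : Matching V) (x : V → ℤ) (u c : V) : ℝ :=
  if M.partner u = u then 0 else if c = u then halfParity M x u else -halfParity M x u

omit [Fintype V] in
theorem balance_eq_average_add (M : Matching V) (x : V → ℤ) (o : EndpointChoice V) (u : V) :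
    (balance M x o u : ℝ) = ((x u : ℝ) + x (M.partner u)) / 2
      + roundingError M x u (o s(u, M.partner u) : V) := by
  unfold balance roundingError halfParity
  by_cases h : M.partner u = u
  · simp [h]
  · simp only [h, if_false]
    have hfl : ∀ k : ℤ, ⌊((k : ℤ) : ℚ) / 2⌋ = k / 2 := fun k => by
      exact_mod_cast Rat.floor_intCast_div_natCast k 2
    have hce : ∀ k : ℤ, ⌈((k : ℤ) : ℚ) / 2⌉ = -((-k) / 2) := fun k => by
      rw [← hfl (-k), ← Int.ceil_neg]
      congr 1
      push_cast
      ring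
    rw [hfl, hce]
    generalize hs : x u + x (M.partner u) = k
    have hk : (x u : ℝ) + x (M.partner u) = k := by exact_mod_cast hs
    rw [hk]
    rcases Int.emod_two_eq_zero_or_one k with h2 | h2
    · obtain ⟨j, rfl⟩ : ∃ j, k = 2 * j := ⟨k / 2, by omega⟩
      have e1 : -(-(2 * j) / 2) = j := by omega
      have e2 : 2 * j / 2 = j := by omega
      simp [e1, e2]
    · obtain ⟨j, rfl⟩ : ∃ j, k = 2 * j + 1 := ⟨k / 2, by omega⟩
      have e1 : -(-(2 * j + 1) / 2) = j + 1 := by omega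
      have e2 : (2 * j + 1) / 2 = j := by omega
      rw [e1, e2, h2]
      split_ifs <;> first | (exfalso; omega) | (push_cast; ring)

omit [Fintype V] [DecidableEq V] in
theorem halfParity_partner (M : Matching V) (x : V → ℤ) (u : V) :
    halfParity M x (M.partner u) = halfParity M x u := by
  unfold halfParity
  rw [M.involutive u, add_comm]

/-- On a matching edge `{a, b}` the error is `±ε` at `a` and `∓ε` at `b` with `0 ≤ ε ≤ 1/2`, so the
two choices add up to `2 cosh (ε (v a - v b))`, and `cosh y ≤ exp (y² / 2)` gives the bound. The
fibre of a matching edge contains both endpoints, so the quarter of the squared half-difference is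
counted twice. Every other unordered pair contributes no error. -/
theorem sum_exp_edge_le (M : Matching V) (x : V → ℤ) (v : V → ℝ) (e : Sym2 V) :
    ∑ c : {w : V // w ∈ e}, Real.exp (∑ u with s(u, M.partner u) = e, roundingError M x u c * v u)
      ≤ Fintype.card {w : V // w ∈ e} *
        Real.exp (∑ u with s(u, M.partner u) = e, 1 / 4 * ((v u - v (M.partner u)) / 2) ^ 2) := by
  by_cases he : ∃ u, M.partner u ≠ u ∧ s(u, M.partner u) = e
  · obtain ⟨a, ha, rfl⟩ := he
    set b := M.partner a with hb
    have hba : M.partner b = a := M.involutive a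
    have hfib : (Finset.univ.filter fun u => s(u, M.partner u) = s(a, b)) = {a, b} := by
      ext u
      simp only [Finset.mem_filter, Finset.mem_univ, true_and, Finset.mem_insert,
        Finset.mem_singleton, Sym2.eq_iff]
      constructor
      · rintro (⟨h, -⟩ | ⟨h, -⟩) <;> simp [h]
      · rintro (rfl | rfl)
        · simp [hb]
        · simp [hba]
    have hsub : ∀ F : V → ℝ, ∑ c : {w : V // w ∈ s(a, b)}, F c = F a + F b := by
      intro F
      rw [← Finset.sum_pair (Ne.symm ha)]
      exact (Finset.sum_subtype {a, b} (by simp) F).symm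
    have hcard : (Fintype.card {w : V // w ∈ s(a, b)} : ℝ) = 2 := by
      have := hsub fun _ => 1
      simp only [Finset.sum_const, Finset.card_univ, nsmul_eq_mul, mul_one] at this
      rw [this]
      norm_num
    rw [hcard, hfib]
    simp_rw [Finset.sum_pair (Ne.symm ha)]
    rw [hsub fun c => Real.exp (roundingError M x a c * v a + roundingError M x b c * v b)]
    have hp : halfParity M x b = halfParity M x a := halfParity_partner M x a
    have hab : ¬ a = b := Ne.symm ha
    have hba' : ¬ b = a := ha
    simp only [roundingError, ← hb, hba, hab, hba', if_true, if_false, hp]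
    set ε := halfParity M x a with hε
    have hε2 : ε ^ 2 ≤ 1 / 4 := by
      rw [hε]; unfold halfParity; split_ifs <;> norm_num
    have hc := Real.cosh_le_exp_half_sq (ε * (v a - v b))
    rw [Real.cosh_eq] at hc
    have e1 : ε * v a + -ε * v b = ε * (v a - v b) := by ring
    have e2 : -ε * v a + ε * v b = -(ε * (v a - v b)) := by ring
    rw [e1, e2]
    have h3 : Real.exp ((ε * (v a - v b)) ^ 2 / 2)
        ≤ Real.exp (1 / 4 * ((v a - v b) / 2) ^ 2 + 1 / 4 * ((v b - v a) / 2) ^ 2) := by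
      apply Real.exp_le_exp.mpr
      nlinarith [mul_le_mul_of_nonneg_right hε2 (sq_nonneg (v a - v b))]
    linarith
  · push Not at he
    have h0 : ∀ c : {w : V // w ∈ e},
        ∑ u with s(u, M.partner u) = e, roundingError M x u c * v u = 0 := by
      intro c
      refine Finset.sum_eq_zero fun u hu => ?_
      have : M.partner u = u := by
        by_contra h
        exact he u h (Finset.mem_filter.mp hu).2
      simp [roundingError, this]
    simp_rw [h0]
    simp only [Real.exp_zero, Finset.sum_const, Finset.card_univ, nsmul_eq_mul, mul_one]
    refine le_mul_of_one_le_right (Nat.cast_nonneg _) (Real.one_le_exp ?_)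
    positivity

/-- Each vertex belongs to exactly one pair `s(u, partner u)`, and a choice function has independent
values on pairs. Summing over all choices therefore factorizes into the one-edge sums. -/
theorem sum_exp_balance_le (M : Matching V) (x : V → ℤ) (v : V → ℝ) :
    ∑ o : EndpointChoice V, Real.exp (∑ u, (balance M x o u : ℝ) * v u)
      ≤ Fintype.card (EndpointChoice V) * Real.exp (∑ u, (x u : ℝ) * (M.matrix.mulVec v) u
        + 1 / 4 * (∑ u, v u ^ 2 - ∑ u, (M.matrix.mulVec v) u ^ 2)) := by
  have h1 : ∀ o : EndpointChoice V, Real.exp (∑ u, (balance M x o u : ℝ) * v u)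
      = Real.exp (∑ u, (x u : ℝ) * (M.matrix.mulVec v) u) * ∏ e : Sym2 V,
        Real.exp (∑ u with s(u, M.partner u) = e, roundingError M x u (o e) * v u) := by
    intro o
    rw [← Real.exp_sum, ← Real.exp_add, ← M.sum_mulVec_mul (fun u => (x u : ℝ)) v]
    congr 1
    rw [← Finset.sum_fiberwise Finset.univ (fun u => s(u, M.partner u))
      (fun u => (balance M x o u : ℝ) * v u),
      ← Finset.sum_fiberwise Finset.univ (fun u => s(u, M.partner u))
      (fun u => ((x u : ℝ) + x (M.partner u)) / 2 * v u), ← Finset.sum_add_distrib]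
    refine Finset.sum_congr rfl fun e _ => ?_
    rw [← Finset.sum_add_distrib]
    refine Finset.sum_congr rfl fun u hu => ?_
    rw [← (Finset.mem_filter.mp hu).2, balance_eq_average_add]
    ring
  simp_rw [h1]
  rw [← Finset.mul_sum]
  have h2 := Finset.prod_univ_sum (fun e : Sym2 V => (Finset.univ : Finset {w : V // w ∈ e}))
    (fun e c => Real.exp (∑ u with s(u, M.partner u) = e, roundingError M x u c * v u))
  rw [Fintype.piFinset_univ] at h2
  have h3 : (Fintype.card (EndpointChoice V) : ℝ)
      = ∏ e : Sym2 V, (Fintype.card {w : V // w ∈ e} : ℝ) := by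
    rw [← Nat.cast_prod, ← Fintype.card_pi]
  have h4 : Real.exp (1 / 4 * (∑ u, v u ^ 2 - ∑ u, (M.matrix.mulVec v) u ^ 2))
      = ∏ e : Sym2 V, Real.exp
        (∑ u with s(u, M.partner u) = e, 1 / 4 * ((v u - v (M.partner u)) / 2) ^ 2) := by
    rw [← Real.exp_sum, M.sum_sq_sub_sum_sq_mulVec, Finset.mul_sum, Finset.sum_fiberwise]
  rw [Real.exp_add, mul_left_comm]
  refine mul_le_mul_of_nonneg_left ?_ (Real.exp_pos _).le
  rw [h3, h4, ← Finset.prod_mul_distrib]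
  have h5 : (∑ o : EndpointChoice V, ∏ e : Sym2 V,
      Real.exp (∑ u with s(u, M.partner u) = e, roundingError M x u (o e) * v u))
      = ∏ e : Sym2 V, ∑ c : {w : V // w ∈ e},
        Real.exp (∑ u with s(u, M.partner u) = e, roundingError M x u c * v u) := by
    rw [h2]
  rw [h5]
  exact Finset.prod_le_prod (fun e _ => by positivity) fun e _ => sum_exp_edge_le M x v e

theorem tsum_balanceLaw_exp_le (M : Matching V) (x : V → ℤ) (v : V → ℝ) :
    ∑' y, balanceLaw M x y * ENNReal.ofReal (Real.exp (∑ u, (y u : ℝ) * v u))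
      ≤ ENNReal.ofReal (Real.exp (∑ u, (x u : ℝ) * (M.matrix.mulVec v) u
        + 1 / 4 * (∑ u, v u ^ 2 - ∑ u, (M.matrix.mulVec v) u ^ 2))) := by
  have h1 : ∑' y, balanceLaw M x y * ENNReal.ofReal (Real.exp (∑ u, (y u : ℝ) * v u))
      = ∑ o : EndpointChoice V, (Fintype.card (EndpointChoice V) : ENNReal)⁻¹
        * ENNReal.ofReal (Real.exp (∑ u, (balance M x o u : ℝ) * v u)) := by
    classical
    unfold balanceLaw
    simp_rw [PMF.map_apply, PMF.uniformOfFintype_apply, ← ENNReal.tsum_mul_right]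
    rw [ENNReal.tsum_comm, tsum_fintype]
    refine Finset.sum_congr rfl fun o _ => ?_
    rw [tsum_eq_single (balance M x o)]
    · simp
    · intro y hy
      simp [hy]
  rw [h1, ← Finset.mul_sum, ← ENNReal.ofReal_sum_of_nonneg fun _ _ => (Real.exp_pos _).le]
  have hc : (Fintype.card (EndpointChoice V) : ENNReal) ≠ 0 := 
    Nat.cast_ne_zero.mpr Fintype.card_ne_zero
  rw [ENNReal.inv_mul_le_iff hc (ENNReal.natCast_ne_top _), ← ENNReal.ofReal_natCast,
    ← ENNReal.ofReal_mul (Nat.cast_nonneg _)]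
  exact ENNReal.ofReal_le_ofReal (sum_exp_balance_le M x v)

end OneStep

/-! ### Exponential moments over many steps. -/

section Steps

variable {V : Type*} [Fintype V] [DecidableEq V] {d : ℕ} [NeZero d]

/-- The product of the first `s` matching matrices of the periodic sequence. -/
noncomputable def stepMatrix (M : Fin d → Matching V) : ℕ → Matrix V V ℝ
  | 0 => 1
  | s + 1 => stepMatrix M s * (M (Fin.ofNat d s)).matrix

theorem stepMatrix_mul_add (M : Fin d → Matching V) (t : ℕ) {j : ℕ} (hj : j ≤ d) :
    stepMatrix M (t * d + j)
      = stepMatrix M (t * d) * ((List.ofFn fun s => (M s).matrix).take j).prod := by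
  induction j with
  | zero => simp
  | succ j ih =>
    have hj' : j < (List.ofFn fun s => (M s).matrix).length := by simpa using hj
    rw [← add_assoc, stepMatrix, ih (by omega), List.prod_take_succ _ _ hj', mul_assoc]
    congr 2
    rw [List.getElem_ofFn]
    congr 2
    ext
    simp [Fin.ofNat, Nat.mod_eq_of_lt (show j < d by omega)]

theorem stepMatrix_mul (M : Fin d → Matching V) (t : ℕ) :
    stepMatrix M (t * d) = roundMatrix M ^ t := by
  induction t with
  | zero => simp [stepMatrix]
  | succ t ih =>
    rw [add_mul, one_mul, stepMatrix_mul_add M t le_rfl, ih, pow_succ, roundMatrix,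
      List.take_of_length_le (by simp)]

theorem stepMatrix_mulVec_const (M : Fin d → Matching V) (c : ℝ) (s : ℕ) :
    (stepMatrix M s).mulVec (fun _ => c) = fun _ => c := by
  induction s with
  | zero => simp [stepMatrix]
  | succ s ih => rw [stepMatrix, ← Matrix.mulVec_mulVec, Matching.matrix_mulVec_const, ih]

theorem sum_stepMatrix_mulVec (M : Fin d → Matching V) (s : ℕ) (v : V → ℝ) :
    ∑ u, ((stepMatrix M s).mulVec v) u = ∑ u, v u := by
  induction s generalizing v with
  | zero => simp [stepMatrix]
  | succ s ih => rw [stepMatrix, ← Matrix.mulVec_mulVec, ih, Matching.sum_matrix_mulVec]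

/-- Induction over steps with `v` varying: conditioning on the load before the last step replaces
`v` by its image under the last matching matrix and pays for the drop of the squared norm. The sum
of the drops is at most `∑ u, v u ^ 2`, uniformly in `s`. -/
theorem tsum_stepLaw_exp_le (M : Fin d → Matching V) (x : V → ℤ) (s : ℕ) (v : V → ℝ) :
    ∑' y, stepLaw M x s y * ENNReal.ofReal (Real.exp (∑ u, (y u : ℝ) * v u))
      ≤ ENNReal.ofReal (Real.exp (∑ u, (x u : ℝ) * ((stepMatrix M s).mulVec v) u
        + 1 / 4 * (∑ u, v u ^ 2 - ∑ u, ((stepMatrix M s).mulVec v) u ^ 2))) := by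
  induction s generalizing v with
  | zero =>
    rw [stepLaw, tsum_eq_single x]
    · simp [stepMatrix]
    · intro y hy
      simp [hy]
  | succ s ih =>
    set N := M (Fin.ofNat d s) with hN
    set w := N.matrix.mulVec v with hw
    have h1 : ∑' y, stepLaw M x (s + 1) y * ENNReal.ofReal (Real.exp (∑ u, (y u : ℝ) * v u))
        = ∑' z, stepLaw M x s z * ∑' y, balanceLaw N z y
          * ENNReal.ofReal (Real.exp (∑ u, (y u : ℝ) * v u)) := by
      simp_rw [stepLaw, PMF.bind_apply, ← ENNReal.tsum_mul_right, ← ENNReal.tsum_mul_left,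
        mul_assoc]
      rw [ENNReal.tsum_comm]
    set δ := 1 / 4 * (∑ u, v u ^ 2 - ∑ u, w u ^ 2) with hδ
    calc _ ≤ ∑' z, stepLaw M x s z * (ENNReal.ofReal (Real.exp (∑ u, (z u : ℝ) * w u))
          * ENNReal.ofReal (Real.exp δ)) := by
          rw [h1]
          gcongr with z
          rw [← ENNReal.ofReal_mul (Real.exp_pos _).le, ← Real.exp_add]
          exact tsum_balanceLaw_exp_le N z v
      _ = (∑' z, stepLaw M x s z * ENNReal.ofReal (Real.exp (∑ u, (z u : ℝ) * w u)))
          * ENNReal.ofReal (Real.exp δ) := by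
          simp_rw [← mul_assoc]
          rw [ENNReal.tsum_mul_right]
      _ ≤ ENNReal.ofReal (Real.exp (∑ u, (x u : ℝ) * ((stepMatrix M s).mulVec w) u
            + 1 / 4 * (∑ u, w u ^ 2 - ∑ u, ((stepMatrix M s).mulVec w) u ^ 2)))
          * ENNReal.ofReal (Real.exp δ) := mul_le_mul_left (ih w) _
      _ = _ := by
          rw [← ENNReal.ofReal_mul (Real.exp_pos _).le, ← Real.exp_add, stepMatrix,
            ← Matrix.mulVec_mulVec, ← hN, ← hw, hδ]
          congr 2
          ring

theorem lintegral_stepLaw_exp_le (M : Fin d → Matching V) (x : V → ℤ) (s : ℕ) (v : V → ℝ) :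
    ∫⁻ y, ENNReal.ofReal (Real.exp (∑ u, (y u : ℝ) * v u)) ∂(stepLaw M x s).toMeasure
      ≤ ENNReal.ofReal (Real.exp (∑ u, (x u : ℝ) * ((stepMatrix M s).mulVec v) u
        + 1 / 4 * ∑ u, v u ^ 2)) := by
  rw [lintegral_countable']
  simp_rw [fun y => PMF.toMeasure_apply_singleton (stepLaw M x s) y (MeasurableSet.singleton y)]
  simp_rw [mul_comm]
  have := tsum_stepLaw_exp_le M x s v
  simp_rw [mul_comm] at this
  refine this.trans (ENNReal.ofReal_le_ofReal (Real.exp_le_exp.mpr ?_))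
  have : 0 ≤ ∑ u, ((stepMatrix M s).mulVec v) u ^ 2 := by positivity
  linarith

end Steps

/-! ### Moments of exponentially concentrated distributions. -/

namespace IsExpConcentrated

variable {D : Measure ℕ} [IsProbabilityMeasure D] {B κ : ℝ}

/-- With zero deviation the tail event would be everything, so `B * exp (-κ δ)` would be at least
`1` for every `δ > 0`. Taking `δ = (B + 1) / κ` contradicts this. -/
theorem distStd_pos (h : IsExpConcentrated D B κ) (hκ : 0 < κ) : 0 < distStd D := by
  refine lt_of_le_of_ne (Real.sqrt_nonneg _) fun h0 => ?_
  have h1 : ∀ δ : ℝ, 0 < δ → 1 ≤ B * Real.exp (-κ * δ) := by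
    intro δ hδ
    have := h.tail δ hδ
    rw [show distStd D = 0 from h0.symm] at this
    simpa using this
  have hB : 0 < B := by
    have := h1 1 one_pos
    by_contra hB
    have : B * Real.exp (-κ * 1) ≤ 0 :=
      mul_nonpos_of_nonpos_of_nonneg (not_lt.mp hB) (Real.exp_pos _).le
    linarith
  have h2 := h1 ((B + 1) / κ) (by positivity)
  have h3 : -κ * ((B + 1) / κ) = -(B + 1) := by field_simp
  rw [h3, Real.exp_neg, ← div_eq_mul_inv, le_div_iff₀ (Real.exp_pos _), one_mul] at h2
  linarith [Real.add_one_le_exp (B + 1)]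

theorem integrable_sub (h : IsExpConcentrated D B κ) :
    Integrable (fun k : ℕ => (k : ℝ) - distMean D) D :=
  (h.memLp_two.integrable one_le_two).sub (integrable_const _)

theorem integral_sub (h : IsExpConcentrated D B κ) :
    ∫ k : ℕ, ((k : ℝ) - distMean D) ∂D = 0 := by
  rw [MeasureTheory.integral_sub (h.memLp_two.integrable one_le_two) (integrable_const _)]
  simp [distMean]

omit [IsProbabilityMeasure D] in
theorem integral_sub_sq (h : IsExpConcentrated D B κ) :
    ∫ k : ℕ, ((k : ℝ) - distMean D) ^ 2 ∂D = distStd D ^ 2 := by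
  rw [distStd, Real.sq_sqrt (variance_nonneg _ _), variance_eq_integral
    h.memLp_two.aestronglyMeasurable.aemeasurable]
  rfl

end IsExpConcentrated

/-- A bound for the exponential moment of order `κ / 2` of a standardized distribution with
exponential concentration. -/
noncomputable def expMomentBound (B κ : ℝ) : ℝ :=
  (1 + B) * Real.exp (κ / 2) * (1 - Real.exp (-(κ / 2)))⁻¹

theorem expMomentBound_pos {B κ : ℝ} (hB : 0 < B) (hκ : 0 < κ) : 0 < expMomentBound B κ := by
  have : Real.exp (-(κ / 2)) < 1 := Real.exp_lt_one_iff.mpr (by linarith)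
  have : 0 < 1 - Real.exp (-(κ / 2)) := by linarith
  unfold expMomentBound
  positivity

namespace IsExpConcentrated

variable {D : Measure ℕ} [IsProbabilityMeasure D] {B κ : ℝ}

/-- Cut the standardized deviation at its integer part `j`: the integrand is at most `exp (κ (j + 1)
/ 2)` there, while the tail decays like `exp (-κ j)`. The product is a geometric series of ratio
`exp (-κ / 2)`. -/
theorem lintegral_exp_abs_le (h : IsExpConcentrated D B κ) (hB : 0 < B) (hκ : 0 < κ) :
    ∫⁻ k : ℕ, ENNReal.ofReal (Real.exp (κ / 2 * (|(k : ℝ) - distMean D| / distStd D))) ∂D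
      ≤ ENNReal.ofReal (expMomentBound B κ) := by
  have hσ := h.distStd_pos hκ
  set σ := distStd D
  set μ := distMean D
  set q := Real.exp (-(κ / 2)) with hq
  have hq1 : q < 1 := Real.exp_lt_one_iff.mpr (by linarith)
  have hq0 : 0 < q := Real.exp_pos _
  let S : ℕ → Set ℕ := fun j => {k : ℕ | (j : ℝ) * σ ≤ |(k : ℝ) - μ|}
  have hpt : ∀ k : ℕ, ENNReal.ofReal (Real.exp (κ / 2 * (|(k : ℝ) - μ| / σ)))
      ≤ ∑' j : ℕ, (S j).indicator
        (fun _ => ENNReal.ofReal (Real.exp (κ / 2 * ((j : ℝ) + 1)))) k := by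
    intro k
    refine le_trans ?_ (ENNReal.le_tsum ⌊|(k : ℝ) - μ| / σ⌋₊)
    have hmem : k ∈ S ⌊|(k : ℝ) - μ| / σ⌋₊ := by
      have : (⌊|(k : ℝ) - μ| / σ⌋₊ : ℝ) ≤ |(k : ℝ) - μ| / σ := Nat.floor_le (by positivity)
      exact (le_div_iff₀ hσ).mp this
    rw [Set.indicator_of_mem hmem]
    refine ENNReal.ofReal_le_ofReal (Real.exp_le_exp.mpr ?_)
    exact mul_le_mul_of_nonneg_left (Nat.lt_floor_add_one _).le (by linarith)
  -- The factor `1 + B` instead of `B` covers `j = 0`, where the tail hypothesis says nothing and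
  -- the trivial bound `1` is used.
  have htail : ∀ j : ℕ, D.real (S j) ≤ (1 + B) * Real.exp (-κ * j) := by
    intro j
    rcases Nat.eq_zero_or_pos j with rfl | hj
    · have : D.real (S 0) ≤ 1 := measureReal_le_one
      simp
      linarith
    · refine (h.tail j (by exact_mod_cast hj)).trans ?_
      have := Real.exp_pos (-κ * j)
      nlinarith
  calc _ ≤ ∫⁻ k : ℕ, ∑' j : ℕ, (S j).indicator
        (fun _ => ENNReal.ofReal (Real.exp (κ / 2 * ((j : ℝ) + 1)))) k ∂D := lintegral_mono hpt
    _ = ∑' j : ℕ, ENNReal.ofReal (Real.exp (κ / 2 * ((j : ℝ) + 1))) * D (S j) := by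
        rw [lintegral_tsum fun j => (Measurable.of_discrete).aemeasurable]
        congr 1
        ext j
        rw [lintegral_indicator_const .of_discrete]
    _ ≤ ∑' j : ℕ, ENNReal.ofReal ((1 + B) * Real.exp (κ / 2) * q ^ j) := by
        refine ENNReal.tsum_le_tsum fun j => ?_
        rw [← ENNReal.ofReal_toReal (measure_ne_top D (S j)),
          ← ENNReal.ofReal_mul (Real.exp_pos _).le]
        refine ENNReal.ofReal_le_ofReal ?_
        refine (mul_le_mul_of_nonneg_left (htail j) (Real.exp_pos _).le).trans (le_of_eq ?_)
        rw [hq, ← Real.exp_nat_mul, mul_left_comm, ← Real.exp_add, mul_assoc, ← Real.exp_add]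
        congr 2
        ring
    _ = ENNReal.ofReal (expMomentBound B κ) := by
        rw [← ENNReal.ofReal_tsum_of_nonneg (fun j => by positivity)
          ((summable_geometric_of_lt_one hq0.le hq1).mul_left _), tsum_mul_left,
          tsum_geometric_of_lt_one hq0.le hq1, expMomentBound]

theorem integrable_exp_abs (h : IsExpConcentrated D B κ) (hB : 0 < B) (hκ : 0 < κ) :
    Integrable (fun k : ℕ => Real.exp (κ / 2 * (|(k : ℝ) - distMean D| / distStd D))) D := by
  refine ⟨Measurable.of_discrete.aestronglyMeasurable, ?_⟩
  rw [hasFiniteIntegral_iff_ofReal (ae_of_all _ fun _ => (Real.exp_pos _).le)]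
  exact (h.lintegral_exp_abs_le hB hκ).trans_lt ENNReal.ofReal_lt_top

theorem integral_exp_abs_le (h : IsExpConcentrated D B κ) (hB : 0 < B) (hκ : 0 < κ) :
    ∫ k : ℕ, Real.exp (κ / 2 * (|(k : ℝ) - distMean D| / distStd D)) ∂D
      ≤ expMomentBound B κ := by
  rw [integral_eq_lintegral_of_nonneg_ae (ae_of_all _ fun _ => (Real.exp_pos _).le)
    Measurable.of_discrete.aestronglyMeasurable]
  exact ENNReal.toReal_le_of_le_ofReal (expMomentBound_pos hB hκ).le
    (h.lintegral_exp_abs_le hB hκ)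

/-- If `f` is dominated by a multiple of the exponential moment function, it is integrable and its
integral is bounded. -/
theorem integrable_and_integral_le_of_le (h : IsExpConcentrated D B κ) (hB : 0 < B) (hκ : 0 < κ)
    {f : ℕ → ℝ} {c : ℝ} (hc : 0 ≤ c) (hf0 : ∀ k, 0 ≤ f k)
    (hf : ∀ k : ℕ, f k ≤ c * Real.exp (κ / 2 * (|(k : ℝ) - distMean D| / distStd D))) :
    Integrable f D ∧ ∫ k, f k ∂D ≤ c * expMomentBound B κ := by
  have hI := (h.integrable_exp_abs hB hκ).const_mul c
  have hfi : Integrable f D := hI.mono' Measurable.of_discrete.aestronglyMeasurable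
    (ae_of_all _ fun k => by rw [Real.norm_of_nonneg (hf0 k)]; exact hf k)
  refine ⟨hfi, (integral_mono hfi hI hf).trans ?_⟩
  rw [integral_const_mul]
  exact mul_le_mul_of_nonneg_left (h.integral_exp_abs_le hB hκ) hc

end IsExpConcentrated

theorem Real.exp_le_one_add_add_sq_mul_exp_abs (s : ℝ) :
    Real.exp s ≤ 1 + s + s ^ 2 * Real.exp |s| := by
  rcases le_or_gt |s| 1 with h | h
  · have h1 := (abs_le.mp (Real.abs_exp_sub_one_sub_id_le h)).2
    have h2 : 1 ≤ Real.exp |s| := Real.one_le_exp (abs_nonneg s)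
    nlinarith [sq_nonneg s]
  · rcases le_or_gt 0 s with h0 | h0
    · rw [abs_of_nonneg h0] at *
      have := Real.exp_pos s
      nlinarith [mul_le_mul_of_nonneg_right (show 1 ≤ s ^ 2 by nlinarith) this.le]
    · have h1 : Real.exp s ≤ 1 := Real.exp_le_one_iff.mpr h0.le
      have h2 : 1 ≤ Real.exp |s| := Real.one_le_exp (abs_nonneg s)
      rw [abs_of_neg h0] at *
      nlinarith [mul_le_mul_of_nonneg_left h2 (sq_nonneg s)]

theorem Real.pow_le_factorial_mul_exp {κ y : ℝ} (hκ : 0 < κ) (hy : 0 ≤ y) (n : ℕ) :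
    y ^ n ≤ (n.factorial : ℝ) * κ⁻¹ ^ n * Real.exp (κ * y) := by
  have h := Real.pow_div_factorial_le_exp (κ * y) (by positivity) n
  rw [div_le_iff₀ (by positivity), mul_pow] at h
  rw [inv_pow, mul_comm (n.factorial : ℝ), mul_assoc, inv_mul_eq_div, le_div_iff₀ (by positivity)]
  linarith

namespace IsExpConcentrated

variable {D : Measure ℕ} [IsProbabilityMeasure D] {B κ : ℝ}

theorem fourth_moment (h : IsExpConcentrated D B κ) (hB : 0 < B) (hκ : 0 < κ) :
    Integrable (fun k : ℕ => ((k : ℝ) - distMean D) ^ 4) D ∧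
      ∫ k : ℕ, ((k : ℝ) - distMean D) ^ 4 ∂D
        ≤ (24 * (κ / 2)⁻¹ ^ 4 * expMomentBound B κ) * distStd D ^ 4 := by
  have hσ := h.distStd_pos hκ
  have := h.integrable_and_integral_le_of_le hB hκ
    (f := fun k : ℕ => ((k : ℝ) - distMean D) ^ 4) (c := distStd D ^ 4 * (24 * (κ / 2)⁻¹ ^ 4))
    (by positivity) (fun k => by positivity) ?_
  · exact ⟨this.1, this.2.trans (le_of_eq (by ring))⟩
  · intro k
    have h1 := Real.pow_le_factorial_mul_exp (half_pos hκ)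
      (show 0 ≤ |(k : ℝ) - distMean D| / distStd D by positivity) 4
    rw [div_pow, div_le_iff₀ (by positivity), (show Even 4 by decide).pow_abs] at h1
    refine h1.trans (le_of_eq ?_)
    norm_num [Nat.factorial]
    ring

/-- Expand to second order: the linear term has mean zero. The remainder `s² exp |s|` is dominated
by the exponential moment of order `κ / 2`, one half of which absorbs `s²` and the other half `exp
|s|`. This is where `|θ| σ ≤ κ / 4` enters. -/
theorem lintegral_exp_le (h : IsExpConcentrated D B κ) (hB : 0 < B) (hκ : 0 < κ) {θ : ℝ}
    (hθ : |θ| * distStd D ≤ κ / 4) :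
    ∫⁻ k : ℕ, ENNReal.ofReal (Real.exp (θ * ((k : ℝ) - distMean D))) ∂D
      ≤ ENNReal.ofReal (Real.exp
        ((2 * (κ / 4)⁻¹ ^ 2 * expMomentBound B κ) * (θ ^ 2 * distStd D ^ 2))) := by
  have hσ := h.distStd_pos hκ
  set σ := distStd D
  set μ := distMean D
  have h1 := h.integrable_and_integral_le_of_le hB hκ
    (f := fun k : ℕ => (θ * ((k : ℝ) - μ)) ^ 2 * Real.exp |θ * ((k : ℝ) - μ)|)
    (c := θ ^ 2 * σ ^ 2 * (2 * (κ / 4)⁻¹ ^ 2)) (by positivity) (fun k => by positivity) ?_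
  · have hlin : Integrable (fun k : ℕ => 1 + θ * ((k : ℝ) - μ)) D :=
      (integrable_const 1).add (h.integrable_sub.const_mul θ)
    have hint : Integrable (fun k : ℕ => 1 + θ * ((k : ℝ) - μ)
        + (θ * ((k : ℝ) - μ)) ^ 2 * Real.exp |θ * ((k : ℝ) - μ)|) D :=
      hlin.add h1.1
    calc _ ≤ ∫⁻ k : ℕ, ENNReal.ofReal (1 + θ * ((k : ℝ) - μ)
        + (θ * ((k : ℝ) - μ)) ^ 2 * Real.exp |θ * ((k : ℝ) - μ)|) ∂D :=
          lintegral_mono fun k =>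
            ENNReal.ofReal_le_ofReal (Real.exp_le_one_add_add_sq_mul_exp_abs _)
      _ = ENNReal.ofReal (∫ k : ℕ, (1 + θ * ((k : ℝ) - μ)
        + (θ * ((k : ℝ) - μ)) ^ 2 * Real.exp |θ * ((k : ℝ) - μ)|) ∂D) :=
          (ofReal_integral_eq_lintegral_ofReal hint (ae_of_all _ fun k =>
            (Real.exp_pos _).le.trans (Real.exp_le_one_add_add_sq_mul_exp_abs _))).symm
      _ ≤ _ := by
          refine ENNReal.ofReal_le_ofReal ?_
          rw [integral_add hlin h1.1,
            integral_add (integrable_const 1) (h.integrable_sub.const_mul θ),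
            integral_const_mul, h.integral_sub]
          simp only [integral_const, probReal_univ, smul_eq_mul, mul_one, mul_zero, add_zero]
          refine le_trans ?_ (Real.add_one_le_exp _)
          linarith [h1.2]
  · intro k
    set y := |(k : ℝ) - μ| / σ with hy
    have hy0 : 0 ≤ y := by positivity
    have hyk : |(k : ℝ) - μ| = y * σ := by rw [hy]; field_simp
    have h2 := Real.pow_le_factorial_mul_exp (show 0 < κ / 4 by linarith) hy0 2
    have h3 : |θ * ((k : ℝ) - μ)| ≤ κ / 4 * y := by
      rw [abs_mul, hyk]
      nlinarith
    have h4 : (θ * ((k : ℝ) - μ)) ^ 2 = θ ^ 2 * σ ^ 2 * y ^ 2 := by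
      rw [mul_pow, ← sq_abs ((k : ℝ) - μ), hyk]
      ring
    rw [h4, show κ / 2 * y = κ / 4 * y + κ / 4 * y by ring, Real.exp_add]
    have h5 : ((2 : ℕ).factorial : ℝ) = 2 := by norm_num [Nat.factorial]
    rw [h5] at h2
    calc θ ^ 2 * σ ^ 2 * y ^ 2 * Real.exp |θ * ((k : ℝ) - μ)|
        ≤ θ ^ 2 * σ ^ 2 * (2 * (κ / 4)⁻¹ ^ 2 * Real.exp (κ / 4 * y)) * Real.exp (κ / 4 * y) := by
          gcongr
      _ = _ := by ring

end IsExpConcentrated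

/-! ### Chernoff bounds for random initial loads. -/

section AverageCase

variable {V : Type*} [Fintype V] [DecidableEq V]

instance isProbabilityMeasure_averageCaseLaw {d : ℕ} [NeZero d] (M : Fin d → Matching V)
    (D : Measure ℕ) [IsProbabilityMeasure D] (t : ℕ) :
    IsProbabilityMeasure (averageCaseLaw M D t) := by
  refine ⟨?_⟩
  rw [averageCaseLaw, Measure.bind_apply .univ Measurable.of_discrete.aemeasurable]
  simp

omit [DecidableEq V] in
theorem sum_natCast_mul_eq (b : V → ℝ) (hb : ∑ w, b w = 0) (μ : ℝ) (x : V → ℕ) :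
    ∑ w, (x w : ℝ) * b w = ∑ w, b w * ((x w : ℝ) - μ) := by
  have : ∑ w, b w * ((x w : ℝ) - μ) = ∑ w, (x w : ℝ) * b w - (∑ w, b w) * μ := by
    rw [Finset.sum_mul, ← Finset.sum_sub_distrib]
    exact Finset.sum_congr rfl fun w _ => by ring
  rw [this, hb]
  ring

-- Because the coefficients sum to zero the loads may be centred. Independence then splits the
-- exponential moment into one factor per vertex.
omit [DecidableEq V] in
theorem lintegral_pi_exp_le {D : Measure ℕ} [IsProbabilityMeasure D] {B κ : ℝ}
    (h : IsExpConcentrated D B κ) (hB : 0 < B) (hκ : 0 < κ) (b : V → ℝ) (hb : ∑ w, b w = 0)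
    (hbσ : ∀ w, |b w| * distStd D ≤ κ / 4) :
    ∫⁻ x : V → ℕ, ENNReal.ofReal (Real.exp (∑ w, (x w : ℝ) * b w)) ∂(Measure.pi fun _ => D)
      ≤ ENNReal.ofReal (Real.exp
        ((2 * (κ / 4)⁻¹ ^ 2 * expMomentBound B κ) * (distStd D ^ 2 * ∑ w, b w ^ 2))) := by
  set μ := distMean D
  have h1 : ∀ x : V → ℕ, ENNReal.ofReal (Real.exp (∑ w, (x w : ℝ) * b w))
      = ∏ w, ENNReal.ofReal (Real.exp (b w * ((x w : ℝ) - μ))) := by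
    intro x
    rw [sum_natCast_mul_eq b hb μ, Real.exp_sum,
      ENNReal.ofReal_prod_of_nonneg fun _ _ => (Real.exp_pos _).le]
  simp_rw [h1]
  have hind : iIndepFun (fun w (x : V → ℕ) =>
      ENNReal.ofReal (Real.exp (b w * ((x w : ℝ) - μ)))) (Measure.pi fun _ => D) :=
    iIndepFun_pi (X := fun w (k : ℕ) => ENNReal.ofReal (Real.exp (b w * ((k : ℝ) - μ))))
      fun _ => Measurable.of_discrete.aemeasurable
  rw [lintegral_prod_eq_prod_lintegral_of_indepFun _ _ hind fun _ => Measurable.of_discrete]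
  have h2 : ∀ w, ∫⁻ x : V → ℕ, ENNReal.ofReal (Real.exp (b w * ((x w : ℝ) - μ)))
      ∂(Measure.pi fun _ => D) = ∫⁻ k : ℕ, ENNReal.ofReal (Real.exp (b w * ((k : ℝ) - μ))) ∂D :=
    fun w => (measurePreserving_eval (fun _ : V => D) w).lintegral_comp
      (f := fun k : ℕ => ENNReal.ofReal (Real.exp (b w * ((k : ℝ) - μ)))) Measurable.of_discrete
  simp_rw [h2]
  refine (Finset.prod_le_prod' fun w _ => h.lintegral_exp_le hB hκ (hbσ w)).trans (le_of_eq ?_)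
  rw [← ENNReal.ofReal_prod_of_nonneg fun _ _ => (Real.exp_pos _).le, ← Real.exp_sum,
    ← Finset.mul_sum, ← Finset.sum_mul, mul_comm (∑ w, b w ^ 2)]

theorem measure_le_of_lintegral_exp_le {Ω : Type*} [MeasurableSpace Ω]
    [DiscreteMeasurableSpace Ω] (P : Measure Ω) (f : Ω → ℝ) (s r : ℝ)
    (h : ∫⁻ y, ENNReal.ofReal (Real.exp (f y)) ∂P ≤ ENNReal.ofReal (Real.exp r)) :
    P {y | s ≤ f y} ≤ ENNReal.ofReal (Real.exp (r - s)) := by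
  have h1 := mul_meas_ge_le_lintegral₀ (μ := P)
    (f := fun y => ENNReal.ofReal (Real.exp (f y))) Measurable.of_discrete.aemeasurable
    (ENNReal.ofReal (Real.exp s))
  have h2 : {y | s ≤ f y} = {y | ENNReal.ofReal (Real.exp s) ≤ ENNReal.ofReal (Real.exp (f y))} := by
    ext y
    simp [ENNReal.ofReal_le_ofReal_iff (Real.exp_pos _).le]
  rw [← h2] at h1
  have h3 : ENNReal.ofReal (Real.exp s) ≠ 0 := by simp [Real.exp_pos]
  rw [Real.exp_sub, ENNReal.ofReal_div_of_pos (Real.exp_pos _),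
    ENNReal.le_div_iff_mul_le (Or.inl h3) (Or.inl ENNReal.ofReal_ne_top), mul_comm]
  exact h1.trans h

variable {d : ℕ} [NeZero d]

theorem lintegral_averageCaseLaw_exp_le (M : Fin d → Matching V)
    {D : Measure ℕ} [IsProbabilityMeasure D] {B κ : ℝ}
    (h : IsExpConcentrated D B κ) (hB : 0 < B) (hκ : 0 < κ) (t : ℕ) (v : V → ℝ)
    (hv : ∑ w, v w = 0)
    (hvσ : ∀ w, |((roundMatrix M ^ t).mulVec v) w| * distStd D ≤ κ / 4) :
    ∫⁻ y, ENNReal.ofReal (Real.exp (∑ u, (y u : ℝ) * v u)) ∂(averageCaseLaw M D t)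
      ≤ ENNReal.ofReal (Real.exp (1 / 4 * ∑ u, v u ^ 2 +
        (2 * (κ / 4)⁻¹ ^ 2 * expMomentBound B κ) *
          (distStd D ^ 2 * ∑ w, ((roundMatrix M ^ t).mulVec v) w ^ 2))) := by
  rw [averageCaseLaw, Measure.lintegral_bind Measurable.of_discrete.aemeasurable
    Measurable.of_discrete.aemeasurable]
  have hsum := sum_stepMatrix_mulVec M (t * d) v
  rw [stepMatrix_mul, hv] at hsum
  calc _ ≤ ∫⁻ x : V → ℕ, ENNReal.ofReal (Real.exp (1 / 4 * ∑ u, v u ^ 2)) * ENNReal.ofReal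
        (Real.exp (∑ u, (x u : ℝ) * ((roundMatrix M ^ t).mulVec v) u))
          ∂(Measure.pi fun _ => D) := by
        refine lintegral_mono fun x => ?_
        refine (lintegral_stepLaw_exp_le M _ (t * d) v).trans (le_of_eq ?_)
        rw [stepMatrix_mul, ← ENNReal.ofReal_mul (Real.exp_pos _).le, ← Real.exp_add, add_comm]
        simp
    _ = ENNReal.ofReal (Real.exp (1 / 4 * ∑ u, v u ^ 2)) * ∫⁻ x : V → ℕ, ENNReal.ofReal
        (Real.exp (∑ u, (x u : ℝ) * ((roundMatrix M ^ t).mulVec v) u))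
          ∂(Measure.pi fun _ => D) := lintegral_const_mul _ Measurable.of_discrete
    _ ≤ _ := by
        rw [Real.exp_add, ENNReal.ofReal_mul (Real.exp_pos _).le]
        gcongr
        exact lintegral_pi_exp_le h hB hκ _ hsum hvσ

/-- The point mass at `u` minus the uniform distribution. -/
noncomputable def centeredPoint (u w : V) : ℝ := (if w = u then 1 else 0) - 1 / (Fintype.card V : ℝ)

theorem sum_centeredPoint (u : V) : ∑ w, centeredPoint u w = 0 := by
  have : (Fintype.card V : ℝ) ≠ 0 := Nat.cast_ne_zero.mpr (Fintype.card_pos_iff.mpr ⟨u⟩).ne'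
  simp only [centeredPoint, Finset.sum_sub_distrib, Finset.sum_ite_eq', Finset.mem_univ, if_true,
    Finset.sum_const, Finset.card_univ, nsmul_eq_mul]
  field_simp
  ring

theorem sum_mul_centeredPoint (u : V) (x : V → ℝ) :
    ∑ w, x w * centeredPoint u w = x u - (∑ w, x w) / Fintype.card V := by
  simp only [centeredPoint, mul_sub, Finset.sum_sub_distrib, mul_ite, mul_one, mul_zero,
    Finset.sum_ite_eq', Finset.mem_univ, if_true, ← Finset.sum_mul]
  ring

theorem sum_centeredPoint_sq_le (u : V) : ∑ w, centeredPoint u w ^ 2 ≤ 1 := by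
  simp_rw [sq]
  rw [sum_mul_centeredPoint, sum_centeredPoint]
  simp [centeredPoint]

theorem roundMatrix_pow_mulVec_centeredPoint (M : Fin d → Matching V) (t : ℕ) (u w : V) :
    ((roundMatrix M ^ t).mulVec (centeredPoint u)) w
      = (roundMatrix M ^ t) w u - 1 / (Fintype.card V : ℝ) := by
  have h1 : centeredPoint u = Pi.single u 1 - fun _ : V => 1 / (Fintype.card V : ℝ) := by
    ext w
    simp [centeredPoint, Pi.single_apply]
  rw [h1, Matrix.mulVec_sub, ← stepMatrix_mul, stepMatrix_mulVec_const]
  simp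

theorem abs_sum_mul_centeredPoint_le_disc [Nonempty V] (u : V) (x : V → ℤ) :
    |∑ w, (x w : ℝ) * centeredPoint u w| ≤ disc x := by
  rw [sum_mul_centeredPoint u fun w => (x w : ℝ), disc]
  set S := Finset.univ.sup' Finset.univ_nonempty x
  set I := Finset.univ.inf' Finset.univ_nonempty x
  have hS : ∀ w, (x w : ℝ) ≤ S := fun w => by
    exact_mod_cast Finset.le_sup' x (Finset.mem_univ w)
  have hI : ∀ w, (I : ℝ) ≤ x w := fun w => by
    exact_mod_cast Finset.inf'_le x (Finset.mem_univ w)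
  have hc : (0 : ℝ) < Fintype.card V := by exact_mod_cast Fintype.card_pos
  have h1 : (∑ w, (x w : ℝ)) / Fintype.card V ≤ S := by
    rw [div_le_iff₀ hc]
    refine (Finset.sum_le_card_nsmul _ _ _ fun w _ => hS w).trans (le_of_eq ?_)
    simp [mul_comm]
  have h2 : (I : ℝ) ≤ (∑ w, (x w : ℝ)) / Fintype.card V := by
    rw [le_div_iff₀ hc]
    refine le_trans (le_of_eq ?_) (Finset.card_nsmul_le_sum _ _ _ fun w _ => hI w)
    simp [mul_comm]
  push_cast
  rw [abs_le]
  constructor <;> linarith [hS u, hI u]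

theorem disc_le_of_abs_sum_mul_centeredPoint_le [Nonempty V] (x : V → ℤ) (T : ℝ)
    (h : ∀ u, |∑ w, (x w : ℝ) * centeredPoint u w| ≤ T / 2) : (disc x : ℝ) ≤ T := by
  obtain ⟨a, -, ha⟩ := Finset.exists_mem_eq_sup' Finset.univ_nonempty x
  obtain ⟨b, -, hb⟩ := Finset.exists_mem_eq_inf' Finset.univ_nonempty x
  rw [disc, ha, hb]
  have h1 := (abs_le.mp (h a)).2
  have h2 := (abs_le.mp (h b)).1
  rw [sum_mul_centeredPoint _ fun w => (x w : ℝ)] at h1 h2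
  push_cast
  linarith

/-- A Chernoff bound for the deviation of a load from the average load. -/
theorem averageCaseLaw_deviation_le (M : Fin d → Matching V)
    {D : Measure ℕ} [IsProbabilityMeasure D] {B κ : ℝ}
    (h : IsExpConcentrated D B κ) (hB : 0 < B) (hκ : 0 < κ) (t : ℕ) (u : V) {b l s : ℝ}
    (hb : ∑ w, ((roundMatrix M ^ t) w u - 1 / (Fintype.card V : ℝ)) ^ 2 ≤ b ^ 2) (hb0 : 0 ≤ b)
    (hl : |l| * b * distStd D ≤ κ / 4) :
    (averageCaseLaw M D t) {y | s ≤ l * ∑ w, (y w : ℝ) * centeredPoint u w}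
      ≤ ENNReal.ofReal (Real.exp (1 / 4 * l ^ 2 + (2 * (κ / 4)⁻¹ ^ 2 * expMomentBound B κ) *
          (l * b * distStd D) ^ 2 - s)) := by
  have hA : ∀ w, ((roundMatrix M ^ t).mulVec (l • centeredPoint u)) w
      = l * ((roundMatrix M ^ t) w u - 1 / (Fintype.card V : ℝ)) := by
    intro w
    rw [Matrix.mulVec_smul, Pi.smul_apply, roundMatrix_pow_mulVec_centeredPoint, smul_eq_mul]
  have hC := expMomentBound_pos hB hκ
  -- The Euclidean norm bounds each entry, so the single condition on `l` keeps all coefficients in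
  -- the range where the one-variable estimate is valid.
  have hle : ∀ w, |(roundMatrix M ^ t) w u - 1 / (Fintype.card V : ℝ)| ≤ b := by
    intro w
    refine abs_le_of_sq_le_sq (le_trans ?_ hb) hb0
    exact Finset.single_le_sum (f := fun w =>
      ((roundMatrix M ^ t) w u - 1 / (Fintype.card V : ℝ)) ^ 2)
      (fun w _ => sq_nonneg _) (Finset.mem_univ w)
  have hσ := h.distStd_pos hκ
  have h1 := lintegral_averageCaseLaw_exp_le M h hB hκ t (l • centeredPoint u)
    (by simp [← Finset.mul_sum, sum_centeredPoint]) (by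
      intro w
      rw [hA, abs_mul]
      refine le_trans ?_ hl
      gcongr
      exact hle w)
  simp_rw [hA] at h1
  have h2 : ∀ y : V → ℤ, ∑ w, (y w : ℝ) * (l • centeredPoint u) w
      = l * ∑ w, (y w : ℝ) * centeredPoint u w := by
    intro y
    rw [Finset.mul_sum]
    exact Finset.sum_congr rfl fun w _ => by simp; ring
  simp_rw [h2] at h1
  refine measure_le_of_lintegral_exp_le _ _ s _ (h1.trans (ENNReal.ofReal_le_ofReal
    (Real.exp_le_exp.mpr (add_le_add ?_ (mul_le_mul_of_nonneg_left ?_ (by positivity))))))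
  · simp only [Pi.smul_apply, smul_eq_mul, mul_pow]
    rw [← Finset.mul_sum]
    nlinarith [sum_centeredPoint_sq_le u, sq_nonneg l]
  · simp only [mul_pow]
    rw [← Finset.mul_sum]
    nlinarith [mul_le_mul_of_nonneg_left hb (mul_nonneg (sq_nonneg l) (sq_nonneg (distStd D)))]

end AverageCase

/-! ### Upper bound on the discrepancy for general circuits. -/

theorem one_le_log_of_four_le {n : ℝ} (hn : 4 ≤ n) : 1 ≤ Real.log n := by
  rw [Real.le_log_iff_exp_le (by linarith)]
  linarith [Real.exp_one_lt_d9]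

/-- The upper bound on the discrepancy for every circuit, in terms of the distance of the columns of the
power of the round matrix from uniform. -/
theorem exists_averageCaseLaw_disc_le (B κ C₁ : ℝ) (hB : 0 < B) (hκ : 0 < κ) (hC₁ : 0 < C₁) :
    ∃ C K : ℝ, 0 < C ∧ 0 < K ∧
      ∀ {V : Type} [Fintype V] [DecidableEq V] [Nonempty V] {d : ℕ} [NeZero d]
        (M : Fin d → Matching V) (t : ℕ) (α : ℝ), 4 ≤ (Fintype.card V : ℝ) → 0 < α →
        (∀ u, ∑ w, ((roundMatrix M ^ t) w u - 1 / (Fintype.card V : ℝ)) ^ 2 ≤ C₁ * α ^ 2) →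
        ∀ (D : Measure ℕ) [IsProbabilityMeasure D], IsExpConcentrated D B κ →
          1 - K / (Fintype.card V : ℝ) ≤ (averageCaseLaw M D t).real
            {x | (disc x : ℝ) ≤ C * (α * distStd D * Real.log (Fintype.card V) ^ (3 / 2 : ℝ)
              + √(Real.log (Fintype.card V)))} := by
  set ρ := κ / 4 / √C₁ with hρ
  have hρ0 : 0 < ρ := by positivity
  set C₀ := 2 * (κ / 4)⁻¹ ^ 2 * expMomentBound B κ with hC₀
  have hC₀0 : 0 < C₀ := by have := expMomentBound_pos hB hκ; positivity
  set m := min 1 ρ with hm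
  have hm0 : 0 < m := lt_min one_pos hρ0
  set q := C₀ * (κ / 4) ^ 2 with hq
  refine ⟨6 / m, 2 * Real.exp q, by positivity, by positivity, ?_⟩
  intro V _ _ _ d _ M t α hn hα hM D _ hD
  set n : ℝ := (Fintype.card V : ℝ) with hndef
  have hn0 : 0 < n := by linarith
  set L := Real.log n with hL
  have hL1 : 1 ≤ L := one_le_log_of_four_le hn
  have hσ := hD.distStd_pos hκ
  set σ := distStd D
  set T := 6 / m * (α * σ * L ^ (3 / 2 : ℝ) + √L) with hT
  -- The Chernoff parameter. The first entry keeps the rounding term `l² / 4` below `L / 4`; the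
  -- second keeps the linear form in its sub-Gaussian range, where it costs at most the constant
  -- `q`.
  set l := min (√L) (ρ / (σ * α)) with hl
  have hl0 : 0 < l := lt_min (by positivity) (by positivity)
  have hlσ : l * (√C₁ * α) * σ ≤ κ / 4 := by
    have : l ≤ ρ / (σ * α) := min_le_right _ _
    rw [le_div_iff₀ (by positivity)] at this
    calc l * (√C₁ * α) * σ = √C₁ * (l * (σ * α)) := by ring
      _ ≤ √C₁ * ρ := by gcongr
      _ = κ / 4 := by rw [hρ]; field_simp
  have hl2 : l ^ 2 ≤ L := by
    calc l ^ 2 ≤ √L ^ 2 := by gcongr; exact min_le_left _ _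
      _ = L := Real.sq_sqrt (by linarith)
  -- The total exponent is then at most `q + L/4 - 3L ≤ q - 2L`, a failure probability of `exp q /
  -- n²`. This survives the union over `2n` one-sided events and yields `K = 2 exp q`.
  have hlT : 3 * L ≤ l * (T / 2) := by
    have key : m * L ≤ l * (α * σ * L ^ (3 / 2 : ℝ) + √L) := by
      -- The argument needs only the first power of the logarithm; the exponent `3/2` is a
      -- weakening.
      have hL32 : L ≤ L ^ (3 / 2 : ℝ) := by
        conv_lhs => rw [← Real.rpow_one L]
        exact Real.rpow_le_rpow_of_exponent_le hL1 (by norm_num)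
      have hL32' : 0 ≤ L ^ (3 / 2 : ℝ) := by linarith
      rcases min_choice (√L) (ρ / (σ * α)) with h | h
      · rw [hl, h]
        have h1 : √L * √L = L := Real.mul_self_sqrt (by linarith)
        have h2 : 0 ≤ √L * (α * σ * L ^ (3 / 2 : ℝ)) := by positivity
        have h3 : m * L ≤ 1 * L := by gcongr; exact min_le_left _ _
        linarith
      · rw [hl, h]
        have h1 : ρ / (σ * α) * (α * σ * L ^ (3 / 2 : ℝ)) = ρ * L ^ (3 / 2 : ℝ) := by
          field_simp
        have h2 : 0 ≤ ρ / (σ * α) * √L := by positivity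
        have h3 : m * L ≤ ρ * L := by gcongr; exact min_le_right _ _
        have h4 : ρ * L ≤ ρ * L ^ (3 / 2 : ℝ) := by gcongr
        linarith
    calc 3 * L = 3 / m * (m * L) := by field_simp
      _ ≤ 3 / m * (l * (α * σ * L ^ (3 / 2 : ℝ) + √L)) := by gcongr
      _ = l * (T / 2) := by rw [hT]; ring
  have hC₁s : √C₁ ^ 2 = C₁ := Real.sq_sqrt hC₁.le
  set P := averageCaseLaw M D t with hP
  have hdev : ∀ (ε : ℝ), |ε| = 1 → ∀ u,
      P {y | l * (T / 2) ≤ (ε * l) * ∑ w, (y w : ℝ) * centeredPoint u w}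
        ≤ ENNReal.ofReal (Real.exp q / n ^ 2) := by
    intro ε hε u
    have hε2 : ε ^ 2 = 1 := by rw [← sq_abs, hε, one_pow]
    refine (averageCaseLaw_deviation_le M hD hB hκ t u (b := √C₁ * α) (by
      rw [mul_pow, hC₁s]; exact hM u) (by positivity) (by
      rw [abs_mul, hε, one_mul, abs_of_pos hl0]; exact hlσ)).trans ?_
    refine ENNReal.ofReal_le_ofReal ?_
    have hn2 : n ^ 2 = Real.exp (2 * L) := by
      rw [hL, two_mul, Real.exp_add, Real.exp_log hn0, sq]
    rw [hn2, ← Real.exp_sub]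
    refine Real.exp_le_exp.mpr ?_
    have h1 : (ε * l) ^ 2 = l ^ 2 := by rw [mul_pow, hε2, one_mul]
    have h2 : (ε * l * (√C₁ * α) * σ) ^ 2 = (l * (√C₁ * α) * σ) ^ 2 := by
      rw [mul_assoc ε, mul_assoc ε, mul_pow, hε2, one_mul]
    rw [h1, h2]
    have h3 : C₀ * (l * (√C₁ * α) * σ) ^ 2 ≤ q := by rw [hq]; gcongr
    linarith
  have hcompl : P {x | (disc x : ℝ) ≤ T}ᶜ ≤ ENNReal.ofReal (2 * Real.exp q / n) := by
    have hsub : {x : V → ℤ | (disc x : ℝ) ≤ T}ᶜ ⊆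
        ⋃ u : V, ({y | l * (T / 2) ≤ (1 * l) * ∑ w, (y w : ℝ) * centeredPoint u w} ∪
          {y | l * (T / 2) ≤ (-1 * l) * ∑ w, (y w : ℝ) * centeredPoint u w}) := by
      intro x hx
      by_contra hcon
      apply hx
      refine disc_le_of_abs_sum_mul_centeredPoint_le x T fun u => ?_
      simp only [Set.mem_iUnion, Set.mem_union, Set.mem_ofPred_eq, not_exists, not_or, not_le]
        at hcon
      obtain ⟨h1, h2⟩ := hcon u
      rw [abs_le]
      constructor
      · have : l * (-∑ w, (x w : ℝ) * centeredPoint u w) < l * (T / 2) := by linarith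
        have := lt_of_mul_lt_mul_left this hl0.le
        linarith
      · have : l * (∑ w, (x w : ℝ) * centeredPoint u w) < l * (T / 2) := by linarith
        exact (lt_of_mul_lt_mul_left this hl0.le).le
    refine (measure_mono hsub).trans ((measure_iUnion_fintype_le P _).trans ?_)
    refine (Finset.sum_le_sum fun u _ => (measure_union_le _ _).trans
      (add_le_add (hdev 1 (by simp) u) (hdev (-1) (by simp) u))).trans (le_of_eq ?_)
    rw [Finset.sum_const, Finset.card_univ, nsmul_eq_mul, ← ENNReal.ofReal_natCast,
      ← ENNReal.ofReal_add (by positivity) (by positivity), ← ENNReal.ofReal_mul (by positivity),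
      ← hndef]
    congr 1
    field_simp
    ring
  have h1 : P.real {x | (disc x : ℝ) ≤ T}ᶜ ≤ 2 * Real.exp q / n :=
    ENNReal.toReal_le_of_le_ofReal (by positivity) hcompl
  rw [probReal_compl_eq_one_sub .of_discrete] at h1
  linarith

/-! ### Fourth moments of independent sums and anti-concentration. -/

section FourthMoment

variable {Ω : Type*} [MeasurableSpace Ω] {P : Measure Ω} [IsProbabilityMeasure P]

theorem integrable_pow_of_integrable_pow_four {f : Ω → ℝ} (hf : Measurable f)
    (h : Integrable (fun ω => f ω ^ 4) P) {k : ℕ} (hk : k ≤ 4) :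
    Integrable (fun ω => f ω ^ k) P := by
  refine ((integrable_const (1 : ℝ)).add h).mono' (hf.pow_const k).aestronglyMeasurable
    (ae_of_all _ fun ω => ?_)
  rw [Real.norm_eq_abs, abs_pow]
  have h4 : f ω ^ 4 = |f ω| ^ 4 := ((show Even 4 by decide).pow_abs _).symm
  simp only [Pi.add_apply, h4]
  rcases le_or_gt |f ω| 1 with h1 | h1
  · have := pow_le_one₀ (n := k) (abs_nonneg (f ω)) h1
    have : 0 ≤ |f ω| ^ 4 := by positivity
    linarith
  · have := pow_le_pow_right₀ h1.le hk
    linarith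

/-- Add one variable at a time. In the expansion of `(S + X)⁴` the terms `S³X` and `S X³` vanish by
independence and centring, and `6 S² X²` is the cross term of `3 (𝔼 S² + 𝔼 X²)²`. -/
theorem sum_moments_of_iIndepFun {ι : Type*} [DecidableEq ι] (X : ι → Ω → ℝ) (hX : iIndepFun X P)
    (hm : ∀ i, Measurable (X i)) (h4 : ∀ i, Integrable (fun ω => X i ω ^ 4) P)
    (h0 : ∀ i, ∫ ω, X i ω ∂P = 0) (s : Finset ι) :
    Integrable (fun ω => (∑ i ∈ s, X i ω) ^ 4) P ∧ ∫ ω, ∑ i ∈ s, X i ω ∂P = 0 ∧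
      ∫ ω, (∑ i ∈ s, X i ω) ^ 2 ∂P = ∑ i ∈ s, ∫ ω, X i ω ^ 2 ∂P ∧
      ∫ ω, (∑ i ∈ s, X i ω) ^ 4 ∂P
        ≤ 3 * (∑ i ∈ s, ∫ ω, X i ω ^ 2 ∂P) ^ 2 + ∑ i ∈ s, ∫ ω, X i ω ^ 4 ∂P := by
  induction s using Finset.induction_on with
  | empty => simp
  | insert j s hj ih =>
    obtain ⟨hS4, hS1, hS2, hSb⟩ := ih
    set S : Ω → ℝ := fun ω => ∑ i ∈ s, X i ω with hS
    have hSm : Measurable S := Finset.measurable_sum s fun i _ => hm i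
    have hind : IndepFun S (X j) P := by
      have := hX.indepFun_finsetSum_of_notMem hm hj
      convert this using 1
      ext ω
      simp [hS]
    have hSp : ∀ k ≤ 4, Integrable (fun ω => S ω ^ k) P := fun k hk =>
      integrable_pow_of_integrable_pow_four hSm hS4 hk
    have hXp : ∀ k ≤ 4, Integrable (fun ω => X j ω ^ k) P := fun k hk =>
      integrable_pow_of_integrable_pow_four (hm j) (h4 j) hk
    have hindp : ∀ k l : ℕ, IndepFun (fun ω => S ω ^ k) (fun ω => X j ω ^ l) P := fun k l =>
      hind.comp (measurable_id.pow_const k) (measurable_id.pow_const l)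
    have hmulI : ∀ k ≤ 4, ∀ l ≤ 4, Integrable (fun ω => S ω ^ k * X j ω ^ l) P :=
      fun k hk l hl => (hindp k l).integrable_mul (hSp k hk) (hXp l hl)
    have hmul : ∀ k l : ℕ, ∫ ω, S ω ^ k * X j ω ^ l ∂P
        = (∫ ω, S ω ^ k ∂P) * ∫ ω, X j ω ^ l ∂P := fun k l =>
      (hindp k l).integral_mul_eq_mul_integral (hSm.pow_const k).aestronglyMeasurable
        ((hm j).pow_const l).aestronglyMeasurable
    have hSi : Integrable S P := by simpa using hSp 1 (by norm_num)
    have hXi : Integrable (X j) P := by simpa using hXp 1 (by norm_num)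
    have e4 : (fun ω => (∑ i ∈ insert j s, X i ω) ^ 4) = fun ω => S ω ^ 4
        + (4 * (S ω ^ 3 * X j ω ^ 1) + (6 * (S ω ^ 2 * X j ω ^ 2)
        + (4 * (S ω ^ 1 * X j ω ^ 3) + X j ω ^ 4))) := by
      ext ω
      rw [Finset.sum_insert hj]
      simp only [hS]
      ring
    have e2 : (fun ω => (∑ i ∈ insert j s, X i ω) ^ 2) = fun ω => S ω ^ 2
        + (2 * (S ω ^ 1 * X j ω ^ 1) + X j ω ^ 2) := by
      ext ω
      rw [Finset.sum_insert hj]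
      simp only [hS]
      ring
    have i31 := (hmulI 3 (by norm_num) 1 (by norm_num)).const_mul 4
    have i22 := (hmulI 2 (by norm_num) 2 (by norm_num)).const_mul 6
    have i13 := (hmulI 1 (by norm_num) 3 (by norm_num)).const_mul 4
    have i11 := (hmulI 1 (by norm_num) 1 (by norm_num)).const_mul 2
    have j1 : Integrable (fun ω => 4 * (S ω ^ 1 * X j ω ^ 3) + X j ω ^ 4) P := i13.add (h4 j)
    have j2 : Integrable (fun ω => 6 * (S ω ^ 2 * X j ω ^ 2)
        + (4 * (S ω ^ 1 * X j ω ^ 3) + X j ω ^ 4)) P := i22.add j1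
    have j3 : Integrable (fun ω => 4 * (S ω ^ 3 * X j ω ^ 1) + (6 * (S ω ^ 2 * X j ω ^ 2)
        + (4 * (S ω ^ 1 * X j ω ^ 3) + X j ω ^ 4))) P := i31.add j2
    have hX1 : ∫ ω, X j ω ^ 1 ∂P = 0 := by simpa using h0 j
    have hS1' : ∫ ω, S ω ^ 1 ∂P = 0 := by simpa using hS1
    have k1 : Integrable (fun ω => 2 * (S ω ^ 1 * X j ω ^ 1) + X j ω ^ 2) P :=
      i11.add (hXp 2 (by norm_num))
    refine ⟨?_, ?_, ?_, ?_⟩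
    · rw [e4]
      exact hS4.add j3
    · simp_rw [Finset.sum_insert hj]
      rw [integral_add hXi hSi, h0, hS1, add_zero]
    · rw [e2, integral_add (hSp 2 (by norm_num)) k1, integral_add i11 (hXp 2 (by norm_num)),
        integral_const_mul, hmul, hX1, Finset.sum_insert hj, hS2]
      ring
    · rw [e4, integral_add hS4 j3, integral_add i31 j2, integral_add i22 j1,
        integral_add i13 (h4 j), integral_const_mul, integral_const_mul, integral_const_mul,
        hmul, hmul, hmul, hX1, hS1', Finset.sum_insert hj, Finset.sum_insert hj, hS2]
      have : 0 ≤ ∫ ω, X j ω ^ 2 ∂P := integral_nonneg fun ω => by positivity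
      nlinarith [sq_nonneg (∫ ω, X j ω ^ 2 ∂P)]

/-- A Paley–Zygmund inequality. -/
theorem two_ninths_le_measureReal_of_fourth_moment_le {Z : Ω → ℝ} (hZ : Measurable Z) {v : ℝ}
    (hv : 0 < v) (h4 : Integrable (fun ω => Z ω ^ 4) P) (h2 : ∫ ω, Z ω ^ 2 ∂P = v)
    (hb : ∫ ω, Z ω ^ 4 ∂P ≤ 13 / 4 * v ^ 2) :
    2 / 9 ≤ P.real {ω | v / 8 ≤ Z ω ^ 2} := by
  have hS : MeasurableSet {ω | v / 8 ≤ Z ω ^ 2} :=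
    measurableSet_le measurable_const (hZ.pow_const 2)
  have hI2 := integrable_pow_of_integrable_pow_four hZ h4 (k := 2) (by norm_num)
  -- With `w = Z² / v`, the left side is `1 - ((w - 1/8)/3 - 1)²`, a parabola with maximum `1` that
  -- is at most `0` for `w ≤ 1/8`. Integrating this minorant of the indicator gives at least `25/36
  -- - 13/36 - 49/576 > 2/9`.
  have hpt : ∀ ω, 25 / 36 / v * Z ω ^ 2 - 1 / 9 / v ^ 2 * Z ω ^ 4 - 49 / 576
      ≤ {ω | v / 8 ≤ Z ω ^ 2}.indicator (fun _ => (1 : ℝ)) ω := by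
    intro ω
    set w := Z ω ^ 2 / v with hw
    have e : 25 / 36 / v * Z ω ^ 2 - 1 / 9 / v ^ 2 * Z ω ^ 4 - 49 / 576
        = 25 / 36 * w - 1 / 9 * w ^ 2 - 49 / 576 := by
      rw [hw]
      field_simp
    rw [e]
    by_cases h : v / 8 ≤ Z ω ^ 2
    · rw [Set.indicator_of_mem (by exact h)]
      nlinarith [sq_nonneg ((w - 1 / 8) / 3 - 1)]
    · rw [Set.indicator_of_notMem (by exact h)]
      have h1 : w < 1 / 8 := by
        rw [hw, div_lt_iff₀ hv]
        linarith [not_le.mp h]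
      have h0 : 0 ≤ w := by positivity
      nlinarith
  have hA : Integrable (fun ω => 25 / 36 / v * Z ω ^ 2) P := hI2.const_mul _
  have hB : Integrable (fun ω => 1 / 9 / v ^ 2 * Z ω ^ 4) P := h4.const_mul _
  have hAB : Integrable (fun ω => 25 / 36 / v * Z ω ^ 2 - 1 / 9 / v ^ 2 * Z ω ^ 4) P := hA.sub hB
  have h := integral_mono (hAB.sub (integrable_const (49 / 576 : ℝ)))
    ((integrable_const (1 : ℝ)).indicator hS) hpt
  rw [integral_indicator_const _ hS] at h
  simp only [Pi.sub_apply] at h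
  rw [integral_sub hAB (integrable_const _), integral_sub hA hB, integral_const_mul,
    integral_const_mul, h2] at h
  simp only [integral_const, probReal_univ, smul_eq_mul, mul_one, one_mul] at h
  have h5 : 1 / 9 / v ^ 2 * ∫ ω, Z ω ^ 4 ∂P ≤ 13 / 36 := by
    calc _ ≤ 1 / 9 / v ^ 2 * (13 / 4 * v ^ 2) := by gcongr
      _ = 13 / 36 := by field_simp; norm_num
  have h6 : 25 / 36 / v * v = 25 / 36 := by field_simp
  linarith

end FourthMoment

/-! ### Lower bound on the discrepancy for general circuits. -/

section AverageCase

variable {V : Type*} [Fintype V]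

/-- Small-ball estimate for a linear combination of independent loads with spread-out coefficients. -/
theorem two_ninths_le_pi_real {D : Measure ℕ} [IsProbabilityMeasure D] {B κ : ℝ}
    (h : IsExpConcentrated D B κ) (hB : 0 < B) (hκ : 0 < κ) (a : V → ℝ) (ha0 : ∑ w, a w = 0)
    {N ε : ℝ} (hN : 0 < N) (haN : ∑ w, a w ^ 2 = N) (hε : ∀ w, a w ^ 2 ≤ ε * N)
    (hεC : (24 * (κ / 2)⁻¹ ^ 4 * expMomentBound B κ) * ε ≤ 1 / 4) :
    2 / 9 ≤ (Measure.pi fun _ : V => D).real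
      {x | distStd D ^ 2 * N / 8 ≤ (∑ w, (x w : ℝ) * a w) ^ 2} := by
  classical
  have hσ := h.distStd_pos hκ
  set C := 24 * (κ / 2)⁻¹ ^ 4 * expMomentBound B κ
  have hC : 0 < C := by have := expMomentBound_pos hB hκ; positivity
  obtain ⟨hI4, hb4⟩ := h.fourth_moment hB hκ
  set σ := distStd D
  set μ := distMean D
  let X : V → (V → ℕ) → ℝ := fun w x => a w * ((x w : ℝ) - μ)
  have hX : iIndepFun X (Measure.pi fun _ : V => D) :=
    iIndepFun_pi (X := fun w (k : ℕ) => a w * ((k : ℝ) - μ)) fun _ =>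
      Measurable.of_discrete.aemeasurable
  have hI : ∀ w, Integrable (fun x => X w x ^ 4) (Measure.pi fun _ : V => D) := by
    intro w
    have : Integrable (fun k : ℕ => (a w * ((k : ℝ) - μ)) ^ 4) D := by
      simp_rw [mul_pow]
      exact hI4.const_mul _
    exact integrable_comp_eval (μ := fun _ : V => D) (i := w) this
  have heval : ∀ w (k : ℕ), ∫ x, X w x ^ k ∂(Measure.pi fun _ : V => D)
      = a w ^ k * ∫ j : ℕ, ((j : ℝ) - μ) ^ k ∂D := by
    intro w k
    rw [← integral_const_mul]
    simp_rw [← mul_pow]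
    exact integral_comp_eval (μ := fun _ : V => D) (i := w)
      (f := fun j : ℕ => (a w * ((j : ℝ) - μ)) ^ k) Measurable.of_discrete.aestronglyMeasurable
  have h0 : ∀ w, ∫ x, X w x ∂(Measure.pi fun _ : V => D) = 0 := by
    intro w
    have := heval w 1
    simp only [pow_one] at this
    rw [this, h.integral_sub, mul_zero]
  obtain ⟨hZ4, -, hZ2, hZb⟩ := sum_moments_of_iIndepFun X hX
    (fun _ => Measurable.of_discrete) hI h0 Finset.univ
  have hsum2 : ∑ w, ∫ x, X w x ^ 2 ∂(Measure.pi fun _ : V => D) = σ ^ 2 * N := by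
    rw [mul_comm, ← haN, Finset.sum_mul]
    refine Finset.sum_congr rfl fun w _ => ?_
    rw [heval, h.integral_sub_sq]
  -- No coefficient dominates: `∑ a⁴ ≤ ε N²`, so the individual fourth moments add at most `1/4` to
  -- the Gaussian constant `3`, which gives the `13/4` of the anti-concentration inequality.
  have hsum4 : ∑ w, ∫ x, X w x ^ 4 ∂(Measure.pi fun _ : V => D) ≤ 1 / 4 * (σ ^ 2 * N) ^ 2 := by
    calc _ ≤ ∑ w, (ε * N * a w ^ 2) * (C * σ ^ 4) := by
          refine Finset.sum_le_sum fun w _ => ?_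
          rw [heval]
          have e : a w ^ 4 = a w ^ 2 * a w ^ 2 := by ring
          rw [e]
          have hεN : 0 ≤ ε * N := (sq_nonneg _).trans (hε w)
          gcongr
          exact hε w
      _ = C * ε * (σ ^ 4 * N ^ 2) := by
          rw [← Finset.sum_mul, ← Finset.mul_sum, haN]
          ring
      _ ≤ 1 / 4 * (σ ^ 4 * N ^ 2) := by gcongr
      _ = _ := by ring
  rw [hsum2] at hZ2 hZb
  have key := two_ninths_le_measureReal_of_fourth_moment_le (P := Measure.pi fun _ : V => D)
    (Z := fun x => ∑ w, X w x) Measurable.of_discrete (v := σ ^ 2 * N) (by positivity) hZ4 hZ2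
    (by linarith)
  simp_rw [sum_natCast_mul_eq a ha0 μ]
  exact key

variable [DecidableEq V] {d : ℕ} [NeZero d]

/-- Conditioned on the initial loads, a load deviates little from the divisible process. -/
theorem stepLaw_disc_lt_le [Nonempty V] (M : Fin d → Matching V) (x : V → ℤ) (t : ℕ) (u : V)
    {L : ℝ} (hL : 1 ≤ L) :
    (stepLaw M x (t * d)).toMeasure {y | (disc y : ℝ) <
        |∑ w, (x w : ℝ) * ((roundMatrix M ^ t) w u - 1 / (Fintype.card V : ℝ))| - 2 * √L}
      ≤ ENNReal.ofReal (2 / 5) := by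
  set Z := ∑ w, (x w : ℝ) * ((roundMatrix M ^ t) w u - 1 / (Fintype.card V : ℝ)) with hZ
  set Q := (stepLaw M x (t * d)).toMeasure
  -- The exponent is at most `l²/4 - 2 l √L = -4L ≤ -4`, and `exp (-4) ≤ 1/5`. Two signs give `2/5`;
  -- there is no union over vertices because only `u` is tested.
  set l := 4 * √L with hl
  have hsL : 1 ≤ √L := Real.one_le_sqrt.mpr hL
  have hl0 : 0 < l := by positivity
  have hdev : ∀ ε : ℝ, ε ^ 2 = 1 →
      Q {y | ε * l * Z + l * (2 * √L) ≤ ε * l * ∑ w, (y w : ℝ) * centeredPoint u w}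
        ≤ ENNReal.ofReal (1 / 5) := by
    intro ε hε
    have h1 := lintegral_stepLaw_exp_le M x (t * d) ((ε * l) • centeredPoint u)
    have h2 : ∀ y : V → ℤ, ∑ w, (y w : ℝ) * ((ε * l) • centeredPoint u) w
        = ε * l * ∑ w, (y w : ℝ) * centeredPoint u w := by
      intro y
      rw [Finset.mul_sum]
      exact Finset.sum_congr rfl fun w _ => by simp; ring
    have h3 : ∑ w, (x w : ℝ) * ((stepMatrix M (t * d)).mulVec ((ε * l) • centeredPoint u)) w
        = ε * l * Z := by
      rw [stepMatrix_mul, Matrix.mulVec_smul, hZ, Finset.mul_sum]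
      refine Finset.sum_congr rfl fun w _ => ?_
      rw [Pi.smul_apply, roundMatrix_pow_mulVec_centeredPoint, smul_eq_mul]
      ring
    simp_rw [h2] at h1
    rw [h3] at h1
    refine (measure_le_of_lintegral_exp_le _ _ _ _ h1).trans (ENNReal.ofReal_le_ofReal ?_)
    have h4 : ∑ w, ((ε * l) • centeredPoint u) w ^ 2 ≤ l ^ 2 := by
      simp only [Pi.smul_apply, smul_eq_mul, mul_pow, hε, one_mul]
      rw [← Finset.mul_sum]
      nlinarith [sum_centeredPoint_sq_le u, sq_nonneg l]
    have h5 : √L * √L = L := Real.mul_self_sqrt (by linarith)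
    have h6 : ε * l * Z + 1 / 4 * ∑ w, ((ε * l) • centeredPoint u) w ^ 2
        - (ε * l * Z + l * (2 * √L)) ≤ -4 := by
      rw [hl] at h4 ⊢
      nlinarith
    refine (Real.exp_le_exp.mpr h6).trans ?_
    rw [Real.exp_neg, one_div]
    exact inv_anti₀ (by norm_num) (by linarith [Real.add_one_le_exp (4 : ℝ)])
  have hsub : {y : V → ℤ | (disc y : ℝ) < |Z| - 2 * √L} ⊆
      {y | 1 * l * Z + l * (2 * √L) ≤ 1 * l * ∑ w, (y w : ℝ) * centeredPoint u w} ∪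
      {y | -1 * l * Z + l * (2 * √L) ≤ -1 * l * ∑ w, (y w : ℝ) * centeredPoint u w} := by
    intro y hy
    have hy' : (disc y : ℝ) < |Z| - 2 * √L := hy
    have h1 := abs_sum_mul_centeredPoint_le_disc u y
    set W := ∑ w, (y w : ℝ) * centeredPoint u w
    have h2 : 2 * √L ≤ |W - Z| := by
      have := abs_sub_abs_le_abs_sub Z W
      rw [abs_sub_comm Z W] at this
      linarith
    rcases le_abs.mp h2 with h3 | h3
    · left
      have := mul_le_mul_of_nonneg_left h3 hl0.le
      simp only [Set.mem_ofPred_eq]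
      linarith
    · right
      have := mul_le_mul_of_nonneg_left h3 hl0.le
      simp only [Set.mem_ofPred_eq]
      linarith
  refine (measure_mono hsub).trans ((measure_union_le _ _).trans ?_)
  refine (add_le_add (hdev 1 (by norm_num)) (hdev (-1) (by norm_num))).trans (le_of_eq ?_)
  rw [← ENNReal.ofReal_add (by norm_num) (by norm_num)]
  norm_num

end AverageCase

/-- The lower bound on the discrepancy for every circuit, in terms of the distance of the columns of the
power of the round matrix from uniform. -/
theorem exists_le_averageCaseLaw_disc (B κ c₁ C₂ : ℝ) (hB : 0 < B) (hκ : 0 < κ) (hc₁ : 0 < c₁)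
    (hC₂ : 0 < C₂) :
    ∃ c C α₀ : ℝ, 0 < c ∧ 0 < C ∧ 0 < α₀ ∧
      ∀ {V : Type} [Fintype V] [DecidableEq V] [Nonempty V] {d : ℕ} [NeZero d]
        (M : Fin d → Matching V) (t : ℕ) (α : ℝ) (u : V), 4 ≤ (Fintype.card V : ℝ) → 0 < α →
        α ≤ α₀ →
        c₁ * α ^ 2 ≤ ∑ w, ((roundMatrix M ^ t) w u - 1 / (Fintype.card V : ℝ)) ^ 2 →
        (∀ w, |(roundMatrix M ^ t) w u - 1 / (Fintype.card V : ℝ)| ≤ C₂ * α ^ 2) →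
        ∀ (D : Measure ℕ) [IsProbabilityMeasure D], IsExpConcentrated D B κ →
          1 / 16 ≤ (averageCaseLaw M D t).real
            {x | c * (α * distStd D / √(Real.log (max (distStd D) 2)))
              - C * √(Real.log (Fintype.card V)) ≤ (disc x : ℝ)} := by
  set C₄ := 24 * (κ / 2)⁻¹ ^ 4 * expMomentBound B κ with hC₄
  have hC₄0 : 0 < C₄ := by have := expMomentBound_pos hB hκ; positivity
  -- A squared coefficient is at most `C₂² α² / c₁` times their sum. For `α² ≤ η` this ratio times
  -- the fourth moment constant `C₄` is at most `1/4`.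
  set η := c₁ / (4 * C₄ * C₂ ^ 2) with hη
  have hη0 : 0 < η := by positivity
  refine ⟨√(c₁ / 8) / 2, 2, √η, by positivity, by norm_num, by positivity, ?_⟩
  intro V _ _ _ d _ M t α u hn hα hα₀ hlow hmax D _ hD
  set n : ℝ := (Fintype.card V : ℝ) with hndef
  set L := Real.log n with hL
  have hL1 : 1 ≤ L := one_le_log_of_four_le hn
  have hσ := hD.distStd_pos hκ
  set a : V → ℝ := fun w => (roundMatrix M ^ t) w u - 1 / n with ha
  set N := ∑ w, a w ^ 2 with hN
  have hN0 : 0 < N := lt_of_lt_of_le (by positivity) hlow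
  have hα2 : α ^ 2 ≤ η := by
    calc α ^ 2 ≤ √η ^ 2 := by gcongr
      _ = η := Real.sq_sqrt hη0.le
  have ha0 : ∑ w, a w = 0 := by
    have := sum_stepMatrix_mulVec M (t * d) (centeredPoint u)
    rw [stepMatrix_mul, sum_centeredPoint] at this
    rw [← this]
    exact Finset.sum_congr rfl fun w _ => (roundMatrix_pow_mulVec_centeredPoint M t u w).symm
  have hG := two_ninths_le_pi_real hD hB hκ a ha0 hN0 hN.symm (ε := C₂ ^ 2 * α ^ 2 / c₁) (by
    intro w
    calc a w ^ 2 = |a w| ^ 2 := (sq_abs _).symm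
      _ ≤ (C₂ * α ^ 2) ^ 2 := by gcongr; exact hmax w
      _ = C₂ ^ 2 * α ^ 2 / c₁ * (c₁ * α ^ 2) := by field_simp
      _ ≤ _ := by gcongr) (by
    rw [← hC₄]
    calc C₄ * (C₂ ^ 2 * α ^ 2 / c₁) ≤ C₄ * (C₂ ^ 2 * η / c₁) := by gcongr
      _ = 1 / 4 := by rw [hη]; field_simp)
  set σ := distStd D
  set G : Set (V → ℕ) := {x | σ ^ 2 * N / 8 ≤ (∑ w, (x w : ℝ) * a w) ^ 2} with hGdef
  set E : Set (V → ℤ) := {x | √(c₁ / 8) / 2 * (α * σ / √(Real.log (max σ 2))) - 2 * √L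
    ≤ (disc x : ℝ)} with hE
  -- Dividing by this root enlarges the threshold by at most a factor `2`, absorbed in the constant;
  -- the bound holds without the logarithm of `σ`.
  have hlog : 1 / 2 ≤ √(Real.log (max σ 2)) := by
    apply Real.le_sqrt_of_sq_le
    have h1 : Real.log 2 ≤ Real.log (max σ 2) :=
      Real.log_le_log (by norm_num) (le_max_right _ _)
    linarith [Real.log_two_gt_d9]
  have hthr : ∀ x ∈ G, √(c₁ / 8) / 2 * (α * σ / √(Real.log (max σ 2)))
      ≤ |∑ w, (x w : ℝ) * a w| := by
    intro x hx
    have hx' : σ ^ 2 * N / 8 ≤ (∑ w, (x w : ℝ) * a w) ^ 2 := hx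
    have h1 : √(c₁ / 8) * (α * σ) ≤ |∑ w, (x w : ℝ) * a w| := by
      refine abs_le_of_sq_le_sq' ?_ (abs_nonneg _) |>.2
      rw [sq_abs, mul_pow, Real.sq_sqrt (by positivity)]
      refine le_trans ?_ hx'
      have := mul_le_mul_of_nonneg_left hlow (sq_nonneg σ)
      nlinarith
    refine le_trans ?_ h1
    have h2 : α * σ / √(Real.log (max σ 2)) ≤ 2 * (α * σ) := by
      rw [div_le_iff₀ (by linarith)]
      nlinarith [mul_pos hα hσ]
    calc _ ≤ √(c₁ / 8) / 2 * (2 * (α * σ)) := by gcongr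
      _ = _ := by ring
  have hcond : ∀ x ∈ G, ENNReal.ofReal (3 / 5)
      ≤ (stepLaw M (fun v => (x v : ℤ)) (t * d)).toMeasure E := by
    intro x hx
    have h1 := stepLaw_disc_lt_le M (fun v => (x v : ℤ)) t u hL1
    set Q := (stepLaw M (fun v => (x v : ℤ)) (t * d)).toMeasure
    have h2 : Eᶜ ⊆ {y : V → ℤ | (disc y : ℝ) <
        |∑ w, (((x w : ℕ) : ℤ) : ℝ) * ((roundMatrix M ^ t) w u - 1 / n)| - 2 * √L} := by
      intro y hy
      have hy' : ¬ (√(c₁ / 8) / 2 * (α * σ / √(Real.log (max σ 2))) - 2 * √L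
        ≤ (disc y : ℝ)) := hy
      have h3 := hthr x hx
      simp only [ha] at h3
      simp only [Set.mem_ofPred_eq, Int.cast_natCast]
      linarith [not_le.mp hy']
    have h3 := (measure_mono h2).trans h1
    have h4 : Q E = 1 - Q Eᶜ := by
      rw [← prob_compl_eq_one_sub .of_discrete, compl_compl]
    rw [h4]
    calc ENNReal.ofReal (3 / 5) = 1 - ENNReal.ofReal (2 / 5) := by
          rw [← ENNReal.ofReal_one, ← ENNReal.ofReal_sub _ (by norm_num)]
          norm_num
      _ ≤ _ := tsub_le_tsub_left h3 _
  -- Favourable initial loads have probability at least `2/9`, and given them the rounding succeeds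
  -- with probability at least `3/5`; the product `2/15` exceeds `1/16`.
  have hfinal : ENNReal.ofReal (3 / 5) * (Measure.pi fun _ : V => D) G
      ≤ averageCaseLaw M D t E := by
    rw [averageCaseLaw, Measure.bind_apply .of_discrete Measurable.of_discrete.aemeasurable]
    calc _ = ∫⁻ _ in G, ENNReal.ofReal (3 / 5) ∂(Measure.pi fun _ : V => D) := by
          rw [setLIntegral_const]
      _ ≤ ∫⁻ x in G, (stepLaw M (fun v => (x v : ℤ)) (t * d)).toMeasure E
          ∂(Measure.pi fun _ : V => D) := setLIntegral_mono Measurable.of_discrete hcond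
      _ ≤ _ := setLIntegral_le_lintegral _ _
  have h7 := ENNReal.toReal_mono (measure_ne_top _ _) hfinal
  rw [ENNReal.toReal_mul, ENNReal.toReal_ofReal (by norm_num)] at h7
  change 3 / 5 * (Measure.pi fun _ : V => D).real G ≤ (averageCaseLaw M D t).real E at h7
  linarith

/-! ### Spectral formulas for simple random walk on the cycle. -/

section Walk

variable (n : ℕ) [NeZero n]

/-- The law of the simple random walk on the cycle, started at `0`. -/
noncomputable def cycleWalk : ℕ → ZMod n → ℝ
  | 0, y => if y = 0 then 1 else 0
  | N + 1, y => (cycleWalk N (y + 1) + cycleWalk N (y - 1)) / 2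

/-- The eigenvalues of the simple random walk on the cycle. -/
noncomputable def cycleEigenvalue (k : ZMod n) : ℝ := Real.cos (2 * Real.pi * k.val / n)

theorem stdAddChar_add_stdAddChar_neg (k : ZMod n) :
    ZMod.stdAddChar k + ZMod.stdAddChar (-k) = 2 * (cycleEigenvalue n k : ℂ) := by
  have h : k = ((k.val : ℤ) : ZMod n) := by simp
  conv_lhs => rw [h]
  rw [← Int.cast_neg, ZMod.stdAddChar_coe, ZMod.stdAddChar_coe, cycleEigenvalue]
  push_cast
  rw [Complex.two_cos]
  congr 2 <;> ring

theorem cycleWalk_eq_sum (N : ℕ) (y : ZMod n) :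
    (cycleWalk n N y : ℂ)
      = 1 / n * ∑ k : ZMod n, (cycleEigenvalue n k : ℂ) ^ N * ZMod.stdAddChar (k * y) := by
  have hn : (n : ℂ) ≠ 0 := Nat.cast_ne_zero.mpr (NeZero.ne n)
  induction N generalizing y with
  | zero =>
    simp only [cycleWalk, pow_zero, one_mul]
    rw [AddChar.sum_mulShift y (ZMod.isPrimitive_stdAddChar n), ZMod.card]
    split_ifs <;> simp [hn]
  | succ N ih =>
    rw [cycleWalk]
    push_cast
    rw [ih, ih, ← mul_add, ← Finset.sum_add_distrib, mul_div_assoc, Finset.sum_div]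
    congr 1
    refine Finset.sum_congr rfl fun k _ => ?_
    have h1 : k * (y + 1) = k * y + k := by ring
    have h2 : k * (y - 1) = k * y + -k := by ring
    rw [h1, h2, AddChar.map_add_eq_mul, AddChar.map_add_eq_mul, ← mul_add, ← mul_add,
      stdAddChar_add_stdAddChar_neg]
    ring

omit [NeZero n] in
theorem cycleWalk_neg (N : ℕ) (y : ZMod n) : cycleWalk n N (-y) = cycleWalk n N y := by
  induction N generalizing y with
  | zero => simp [cycleWalk]
  | succ N ih =>
    rw [cycleWalk, cycleWalk, ← ih (y + 1), ← ih (y - 1), add_comm (cycleWalk n N (-y + 1))]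
    congr 3 <;> ring

theorem cycleWalk_zero_eq_sum (N : ℕ) :
    cycleWalk n N 0 = 1 / n * ∑ k : ZMod n, cycleEigenvalue n k ^ N := by
  have := cycleWalk_eq_sum n N 0
  simp only [mul_zero, AddChar.map_zero_eq_one, mul_one] at this
  rw [← Complex.ofReal_inj]
  push_cast
  exact this

/-- Symmetry of the walk makes the sum of squares a convolution at `0`, that is, a return
probability at twice the time. The proof is Plancherel: expand one factor at `-y` and use
orthogonality of characters. -/
theorem sum_cycleWalk_sq (N : ℕ) : ∑ y, cycleWalk n N y ^ 2 = cycleWalk n (2 * N) 0 := by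
  have hn : (n : ℂ) ≠ 0 := Nat.cast_ne_zero.mpr (NeZero.ne n)
  rw [← Complex.ofReal_inj, cycleWalk_zero_eq_sum]
  push_cast
  have h1 : ∀ y, (cycleWalk n N y : ℂ) ^ 2 = (cycleWalk n N y : ℂ) *
      (1 / n * ∑ k : ZMod n, (cycleEigenvalue n k : ℂ) ^ N * ZMod.stdAddChar (k * -y)) := by
    intro y
    rw [← cycleWalk_eq_sum, cycleWalk_neg, sq]
  simp_rw [h1, Finset.mul_sum]
  rw [Finset.sum_comm]
  refine Finset.sum_congr rfl fun k _ => ?_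
  have h2 : ∀ y, (cycleWalk n N y : ℂ) * (1 / n * ((cycleEigenvalue n k : ℂ) ^ N
      * ZMod.stdAddChar (k * -y))) = 1 / n * (cycleEigenvalue n k : ℂ) ^ N *
      (1 / n * ∑ l : ZMod n, (cycleEigenvalue n l : ℂ) ^ N * ZMod.stdAddChar (y * (l - k))) := by
    intro y
    rw [cycleWalk_eq_sum]
    have : ∀ l : ZMod n, ZMod.stdAddChar (y * (l - k))
        = ZMod.stdAddChar (l * y) * ZMod.stdAddChar (N := n) (k * -y) := by
      intro l
      rw [← AddChar.map_add_eq_mul]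
      congr 1
      ring
    simp_rw [this, ← mul_assoc]
    rw [← Finset.sum_mul]
    ring
  simp_rw [h2]
  rw [← Finset.mul_sum, ← Finset.mul_sum, Finset.sum_comm]
  simp_rw [← Finset.mul_sum, AddChar.sum_mulShift _ (ZMod.isPrimitive_stdAddChar n), sub_eq_zero]
  rw [Finset.sum_eq_single k (by intro l _ hl; simp [hl]) (by simp), if_pos rfl, ZMod.card]
  field_simp
  ring

theorem abs_cycleWalk_le (N : ℕ) (y : ZMod n) :
    |cycleWalk n N y| ≤ 1 / n * ∑ k : ZMod n, |cycleEigenvalue n k| ^ N := by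
  have h : |cycleWalk n N y| = ‖(cycleWalk n N y : ℂ)‖ := by simp
  rw [h, cycleWalk_eq_sum, norm_mul]
  have h1 : ‖(1 / n : ℂ)‖ = 1 / n := by simp
  rw [h1]
  gcongr
  refine (norm_sum_le _ _).trans (Finset.sum_le_sum fun k _ => ?_)
  rw [norm_mul, norm_pow, ZMod.stdAddChar_apply, Circle.norm_coe, mul_one]
  simp

theorem sum_zmod_val {A : Type*} [AddCommMonoid A] (f : ℕ → A) :
    ∑ k : ZMod n, f k.val = ∑ i ∈ Finset.range n, f i := by
  refine Finset.sum_nbij ZMod.val (fun k _ => Finset.mem_range.mpr (ZMod.val_lt k))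
    (fun a _ b _ h => ZMod.val_injective n h) (fun i hi => ?_) fun _ _ => rfl
  exact ⟨i, by simp, ZMod.val_cast_of_lt (Finset.mem_range.mp hi)⟩

end Walk

/-- The sum of the powers of the absolute values of the eigenvalues other than `1` and `-1` of the cycle
of length `2 * h`, each counted once instead of twice. -/
noncomputable def cycleTrace (h N : ℕ) : ℝ :=
  ∑ i ∈ Finset.range (h - 1), |Real.cos (Real.pi * (i + 1 : ℝ) / h)| ^ N

/-- Frequencies `i` and `h + i` have opposite cosines, hence the factor `2`; frequency `0` and its
partner, with eigenvalues `1` and `-1`, give the summand `1`. -/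
theorem sum_abs_cycleEigenvalue_pow (n : ℕ) [NeZero n] {h : ℕ} (hn : n = 2 * h) (N : ℕ) :
    ∑ k : ZMod n, |cycleEigenvalue n k| ^ N = 2 * (1 + cycleTrace h N) := by
  have hh : 0 < h := by have := NeZero.pos n; omega
  have hh0 : (h : ℝ) ≠ 0 := by positivity
  have h1 := sum_zmod_val n fun i => |Real.cos (2 * Real.pi * i / n)| ^ N
  simp only [cycleEigenvalue]
  rw [h1, hn, two_mul h, Finset.sum_range_add]
  have h2 : ∀ i : ℕ, Real.cos (2 * Real.pi * i / (h + h : ℕ)) = Real.cos (Real.pi * i / h) := by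
    intro i
    congr 1
    push_cast
    field_simp
    ring
  have h3 : ∀ i : ℕ, |Real.cos (Real.pi * (h + i : ℕ) / h)| = |Real.cos (Real.pi * i / h)| := by
    intro i
    have : Real.pi * (h + i : ℕ) / h = Real.pi * i / h + Real.pi := by
      push_cast
      field_simp
      ring
    rw [this, Real.cos_add_pi, abs_neg]
  simp_rw [h2, h3]
  rw [← two_mul]
  congr 1
  obtain ⟨g, rfl⟩ : ∃ g, h = g + 1 := ⟨h - 1, by omega⟩
  rw [Finset.sum_range_succ', cycleTrace, add_comm]
  simp

/-! ### Columns of the cycle round matrix as random walk profiles. -/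

section Column

variable {n : ℕ} [NeZero n]

/-- The parity of a vertex of the cycle. -/
def zmodParity (hn : Even n) : ZMod n →+* ZMod 2 := ZMod.castHom hn.two_dvd (ZMod 2)

omit [NeZero n] in
theorem cycleWalk_eq_zero_of_parity (hn : Even n) (N : ℕ) (y : ZMod n)
    (h : zmodParity hn y ≠ N) : cycleWalk n N y = 0 := by
  induction N generalizing y with
  | zero =>
    rw [cycleWalk, if_neg]
    rintro rfl
    simp at h
  | succ N ih =>
    have key : ∀ a b : ZMod 2, a ≠ b + 1 → a + 1 ≠ b ∧ a - 1 ≠ b := by decide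
    push_cast at h
    obtain ⟨h1, h2⟩ := key _ _ h
    rw [cycleWalk, ih (y + 1) (by simpa using h1), ih (y - 1) (by simpa using h2)]
    simp

theorem val_mod_two_eq_iff (hn : Even n) (u : ZMod n) (q : Fin 2) :
    u.val % 2 = q ↔ zmodParity hn u = (q.val : ZMod 2) := by
  have h1 : zmodParity hn u = (u.val : ZMod 2) := by
    conv_lhs => rw [← ZMod.natCast_zmod_val u]
    rw [map_natCast]
  rw [h1, ZMod.natCast_eq_natCast_iff, Nat.ModEq, Nat.mod_eq_of_lt q.isLt]

/-- The load profile obtained from a unit load on the edge `{b, b + 1}` after `j` further matchings. -/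
noncomputable def cycleProfile (b : ZMod n) (j : ℕ) (w : ZMod n) : ℝ :=
  (cycleWalk n j (w - b) + cycleWalk n j (w - 1 - b)) / 2

/-- After `j` further matchings both ends of every edge `{w, w + 1}` just used, with `w` of the
parity of `j`, carry half of the walk's mass at `w - b`. The next matching averages one end from
each of two neighbouring edges, which is one walk step on left endpoints. By parity exactly one of
the two terms of the profile can be nonzero at each vertex. -/
theorem mulVec_cycleProfile (hn : Even n) {b : ZMod n} (hb : zmodParity hn b = 0) (j : ℕ)
    {q : Fin 2} (hq : (q.val : ZMod 2) = (j : ZMod 2) + 1) :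
    (cycleMatching n hn q).matrix.mulVec (cycleProfile b j) = cycleProfile b (j + 1) := by
  ext w
  rw [Matching.matrix_mulVec]
  simp only [cycleMatching, cyclePartner, cycleProfile]
  have k1 : ∀ a c : ZMod 2, a = c + 1 → a ≠ c ∧ a - 1 ≠ c + 1 := by decide
  have k2 : ∀ a c : ZMod 2, a ≠ c + 1 → a - 1 ≠ c ∧ a ≠ c + 1 := by decide
  by_cases h : w.val % 2 = q
  · rw [if_pos h]
    rw [val_mod_two_eq_iff hn, hq] at h
    obtain ⟨h1, h2⟩ := k1 _ _ h
    have z1 : cycleWalk n j (w - b) = 0 :=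
      cycleWalk_eq_zero_of_parity hn _ _ (by simpa [hb] using h1)
    have z2 : cycleWalk n (j + 1) (w - 1 - b) = 0 :=
      cycleWalk_eq_zero_of_parity hn _ _ (by simpa [hb] using h2)
    rw [z2, show w + 1 - 1 - b = w - b by ring, z1, cycleWalk,
      show w - b + 1 = w + 1 - b by ring, show w - b - 1 = w - 1 - b by ring]
    ring
  · rw [if_neg h]
    rw [val_mod_two_eq_iff hn, hq] at h
    obtain ⟨h1, h2⟩ := k2 _ _ h
    have z1 : cycleWalk n j (w - 1 - b) = 0 :=
      cycleWalk_eq_zero_of_parity hn _ _ (by simpa [hb] using h1)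
    have z2 : cycleWalk n (j + 1) (w - b) = 0 :=
      cycleWalk_eq_zero_of_parity hn _ _ (by simpa [hb] using h2)
    rw [z2, z1, cycleWalk, show w - 1 - b + 1 = w - b by ring,
      show w - 1 - b - 1 = w - 1 - 1 - b by ring]
    ring

theorem exists_mulVec_single_eq_cycleProfile (hn : Even n) (u : ZMod n) :
    ∃ b : ZMod n, zmodParity hn b = 0 ∧
      (cycleMatching n hn 0).matrix.mulVec (Pi.single u 1) = cycleProfile b 0 := by
  have hcol : ∀ w, (cycleMatching n hn 0).matrix.mulVec (Pi.single u 1) w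
      = ((if w = u then 1 else 0) + (if w = cyclePartner n 0 u then 1 else 0)) / 2 := by
    intro w
    rw [Matching.matrix_mulVec, Pi.single_apply, Pi.single_apply]
    have : (cycleMatching n hn 0).partner w = u ↔ w = cyclePartner n 0 u := by
      have hi := cyclePartner_involutive n hn 0
      constructor
      · intro h
        rw [← h]
        exact (hi w).symm
      · rintro rfl
        exact hi u
    simp only [this]
  by_cases h : u.val % 2 = (0 : Fin 2)
  · refine ⟨u, ?_, ?_⟩
    · rw [val_mod_two_eq_iff hn] at h
      simpa using h
    · ext w
      rw [hcol, cycleProfile, cyclePartner, if_pos h, cycleWalk, cycleWalk]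
      simp only [sub_eq_iff_eq_add]
      simp [add_comm]
  · refine ⟨u - 1, ?_, ?_⟩
    · rw [val_mod_two_eq_iff hn] at h
      have key : ∀ a : ZMod 2, a ≠ 0 → a - 1 = 0 := by decide
      simpa using key _ (by simpa using h)
    · ext w
      rw [hcol, cycleProfile, cyclePartner, if_neg h, cycleWalk, cycleWalk]
      simp only [sub_eq_iff_eq_add]
      simp [add_comm]

theorem roundMatrix_cycleCircuit (hn : Even n) :
    roundMatrix (cycleCircuit n hn)
      = (cycleMatching n hn 1).matrix * (cycleMatching n hn 0).matrix := by
  simp [roundMatrix, cycleCircuit, List.ofFn_succ]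

/-- Acting on a column, the round matrix applies its last factor, the matching of parity `0`, first.
That very first matching only spreads the unit load over one edge, so `t + 1` rounds amount to `2 t
+ 1` walk steps rather than `2 t + 2`. -/
theorem exists_roundMatrix_cycleCircuit_pow (hn : Even n) (u : ZMod n) :
    ∃ b : ZMod n, zmodParity hn b = 0 ∧ ∀ t w,
      (roundMatrix (cycleCircuit n hn) ^ (t + 1)) w u = cycleProfile b (2 * t + 1) w := by
  obtain ⟨b, hb, h0⟩ := exists_mulVec_single_eq_cycleProfile hn u
  refine ⟨b, hb, fun t w => ?_⟩
  suffices h : (roundMatrix (cycleCircuit n hn) ^ (t + 1)).mulVec (Pi.single u 1)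
      = cycleProfile b (2 * t + 1) by
    rw [← h]
    simp
  have key : ∀ a : ZMod 2, (1 : ZMod 2) = 2 * a + 1 + 1 + 1 ∧ (0 : ZMod 2) = 2 * a + 1 + 1 := by decide
  induction t with
  | zero =>
    rw [zero_add, pow_one, roundMatrix_cycleCircuit, ← Matrix.mulVec_mulVec, h0]
    exact mulVec_cycleProfile hn hb 0 (by simp)
  | succ t ih =>
    rw [pow_succ', ← Matrix.mulVec_mulVec, ih, roundMatrix_cycleCircuit, ← Matrix.mulVec_mulVec,
      mulVec_cycleProfile hn hb (2 * t + 1) (by simpa using (key t).2),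
      mulVec_cycleProfile hn hb (2 * t + 1 + 1) (by simpa using (key t).1)]
    rfl

/-- The two shifted walks in the profile live on opposite parity classes, so the cross term
vanishes. -/
theorem sum_cycleProfile_sq (hn : Even n) (b : ZMod n) (j : ℕ) :
    ∑ w, cycleProfile b j w ^ 2 = 1 / 2 * cycleWalk n (2 * j) 0 := by
  have h1 : ∀ w, cycleProfile b j w ^ 2
      = 1 / 4 * (cycleWalk n j (w - b) ^ 2 + cycleWalk n j (w - (1 + b)) ^ 2) := by
    intro w
    have hz : cycleWalk n j (w - b) * cycleWalk n j (w - 1 - b) = 0 := by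
      have key : ∀ a c : ZMod 2, a ≠ c ∨ a - 1 ≠ c := by decide
      rcases key (zmodParity hn (w - b)) j with h | h
      · rw [cycleWalk_eq_zero_of_parity hn _ _ h, zero_mul]
      · rw [cycleWalk_eq_zero_of_parity hn j (w - 1 - b), mul_zero]
        rw [show w - 1 - b = w - b - 1 by ring, map_sub, map_one]
        exact h
    rw [cycleProfile, show w - (1 + b) = w - 1 - b by ring]
    linear_combination (1 / 2) * hz
  have h2 : ∀ c : ZMod n, ∑ w, cycleWalk n j (w - c) ^ 2 = ∑ w, cycleWalk n j w ^ 2 := fun c =>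
    Equiv.sum_comp (Equiv.subRight c) fun y => cycleWalk n j y ^ 2
  simp_rw [h1]
  rw [← Finset.mul_sum, Finset.sum_add_distrib, h2, h2, sum_cycleWalk_sq]
  ring

end Column

theorem sum_roundMatrix_pow_apply {V : Type*} [Fintype V] [DecidableEq V] {d : ℕ} [NeZero d]
    (M : Fin d → Matching V) (t : ℕ) (u : V) : ∑ w, (roundMatrix M ^ t) w u = 1 := by
  have := sum_stepMatrix_mulVec M (t * d) (Pi.single u 1)
  rw [stepMatrix_mul] at this
  simpa using this

theorem sum_roundMatrix_pow_sub_sq {V : Type*} [Fintype V] [DecidableEq V] {d : ℕ} [NeZero d]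
    (M : Fin d → Matching V) (t : ℕ) (u : V) :
    ∑ w, ((roundMatrix M ^ t) w u - 1 / (Fintype.card V : ℝ)) ^ 2
      = ∑ w, (roundMatrix M ^ t) w u ^ 2 - 1 / (Fintype.card V : ℝ) := by
  have hc : (Fintype.card V : ℝ) ≠ 0 := Nat.cast_ne_zero.mpr (Fintype.card_pos_iff.mpr ⟨u⟩).ne'
  have h : ∀ w, ((roundMatrix M ^ t) w u - 1 / (Fintype.card V : ℝ)) ^ 2
      = (roundMatrix M ^ t) w u ^ 2 - 2 / (Fintype.card V : ℝ) * (roundMatrix M ^ t) w u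
        + 1 / (Fintype.card V : ℝ) ^ 2 := fun w => by ring
  simp_rw [h]
  rw [Finset.sum_add_distrib, Finset.sum_sub_distrib, ← Finset.mul_sum, sum_roundMatrix_pow_apply,
    Finset.sum_const, Finset.card_univ, nsmul_eq_mul]
  field_simp
  ring

section CycleFormulas

variable {n : ℕ} [NeZero n]

theorem sum_roundMatrix_cycleCircuit_pow_sq (hn : Even n) {h : ℕ} (hh : n = 2 * h) {t : ℕ}
    (ht : 1 ≤ t) (u : ZMod n) :
    ∑ w, (roundMatrix (cycleCircuit n hn) ^ t) w u ^ 2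
      = 1 / (n : ℝ) + cycleTrace h (4 * t - 2) / n := by
  obtain ⟨s, rfl⟩ : ∃ s, t = s + 1 := ⟨t - 1, by omega⟩
  obtain ⟨b, -, hP⟩ := exists_roundMatrix_cycleCircuit_pow hn u
  simp_rw [hP]
  rw [sum_cycleProfile_sq hn, show 4 * (s + 1) - 2 = 2 * (2 * s + 1) by omega,
    cycleWalk_zero_eq_sum]
  have h1 := sum_abs_cycleEigenvalue_pow n hh (2 * (2 * s + 1))
  have he : Even (2 * (2 * s + 1)) := even_two_mul _
  simp_rw [he.pow_abs] at h1
  rw [h1]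
  ring

theorem abs_roundMatrix_cycleCircuit_pow_le (hn : Even n) {h : ℕ} (hh : n = 2 * h) {t : ℕ}
    (ht : 1 ≤ t) (w u : ZMod n) :
    |(roundMatrix (cycleCircuit n hn) ^ t) w u| ≤ 2 / n * (1 + cycleTrace h (2 * t - 1)) := by
  obtain ⟨s, rfl⟩ : ∃ s, t = s + 1 := ⟨t - 1, by omega⟩
  obtain ⟨b, -, hP⟩ := exists_roundMatrix_cycleCircuit_pow hn u
  rw [hP, show 2 * (s + 1) - 1 = 2 * s + 1 by omega, cycleProfile]
  have h1 := abs_cycleWalk_le n (2 * s + 1) (w - b)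
  have h2 := abs_cycleWalk_le n (2 * s + 1) (w - 1 - b)
  rw [sum_abs_cycleEigenvalue_pow n hh] at h1 h2
  rw [abs_div, abs_two, div_le_iff₀ two_pos]
  refine (abs_add_le _ _).trans ((add_le_add h1 h2).trans (le_of_eq ?_))
  ring

end CycleFormulas

/-! ### Upper and lower bounds for the cosine sum. -/

section TraceBounds

theorem abs_cos_pow_le (x : ℝ) (N : ℕ) :
    |Real.cos x| ^ N ≤ Real.exp (-(N * Real.sin x ^ 2 / 2)) := by
  have h1 : |Real.cos x| ≤ Real.exp (-(Real.sin x ^ 2 / 2)) := by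
    refine abs_le_of_sq_le_sq ?_ (Real.exp_pos _).le
    rw [← Real.exp_nat_mul]
    have := Real.add_one_le_exp (-(Real.sin x ^ 2))
    have h2 : ((2 : ℕ) : ℝ) * -(Real.sin x ^ 2 / 2) = -(Real.sin x ^ 2) := by push_cast; ring
    rw [h2]
    linarith [Real.sin_sq_add_cos_sq x]
  refine (pow_le_pow_left₀ (abs_nonneg _) h1 N).trans (le_of_eq ?_)
  rw [← Real.exp_nat_mul]
  congr 1
  ring

theorem cycleTrace_antitone (h : ℕ) : Antitone (cycleTrace h) := fun _ _ hNM =>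
  Finset.sum_le_sum fun _ _ =>
    pow_le_pow_of_le_one (abs_nonneg _) (Real.abs_cos_le_one _) hNM

theorem cycleTrace_nonneg (h N : ℕ) : 0 ≤ cycleTrace h N :=
  Finset.sum_nonneg fun _ _ => by positivity

/-- Use `cos² ≤ exp (-sin²)` and, up to the angle `π/2`, Jordan's inequality. Angles beyond `π/2`
are reflected to `π - x`; bounding each term by both candidates and reversing the sum produces the
factor `2`. -/
theorem cycleTrace_le (h N : ℕ) :
    cycleTrace h N ≤ 2 * ∑ i ∈ Finset.range (h - 1),
      Real.exp (-(2 * N / (h : ℝ) ^ 2) * (i + 1 : ℝ) ^ 2) := by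
  rcases Nat.eq_zero_or_pos h with rfl | hh
  · simp [cycleTrace]
  have hh0 : (0 : ℝ) < h := by exact_mod_cast hh
  have hsin : ∀ j : ℝ, 0 ≤ j → j ≤ h / 2 →
      Real.exp (-(N * Real.sin (Real.pi * j / h) ^ 2 / 2))
        ≤ Real.exp (-(2 * N / (h : ℝ) ^ 2) * j ^ 2) := by
    intro j hj0 hj
    have h1 : 2 * j / h ≤ Real.sin (Real.pi * j / h) := by
      have := Real.mul_le_sin (x := Real.pi * j / h) (by positivity) (by
        rw [div_le_iff₀ hh0]
        nlinarith [Real.pi_pos])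
      refine le_trans (le_of_eq ?_) this
      field_simp
    have h2 : (2 * j / h) ^ 2 ≤ Real.sin (Real.pi * j / h) ^ 2 := by gcongr
    refine Real.exp_le_exp.mpr ?_
    have h3 := mul_le_mul_of_nonneg_left h2 (Nat.cast_nonneg (α := ℝ) N)
    have h4 : (N : ℝ) * (2 * j / h) ^ 2 = 2 * (2 * N / (h : ℝ) ^ 2 * j ^ 2) := by
      field_simp
    rw [h4] at h3
    linarith
  set f : ℕ → ℝ := fun i => Real.exp (-(2 * N / (h : ℝ) ^ 2) * (i + 1 : ℝ) ^ 2) with hf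
  have hterm : ∀ i ∈ Finset.range (h - 1), |Real.cos (Real.pi * (i + 1 : ℝ) / h)| ^ N
      ≤ f i + f (h - 1 - 1 - i) := by
    intro i hi
    have hi' : i < h - 1 := Finset.mem_range.mp hi
    refine (abs_cos_pow_le _ N).trans ?_
    have hcast : ((h - 1 - 1 - i : ℕ) : ℝ) + 1 = h - (i + 1) := by
      have h2 : h - 1 - 1 - i + 1 + (i + 1) = h := by omega
      have h3 : (((h - 1 - 1 - i + 1 + (i + 1) : ℕ)) : ℝ) = h := by rw [h2]
      push_cast at h3
      linarith
    have hle : (i : ℝ) + 1 ≤ h := by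
      have : i + 1 ≤ h := by omega
      exact_mod_cast this
    rcases le_or_gt ((i : ℝ) + 1) (h / 2) with hc | hc
    · have := hsin (i + 1) (by positivity) hc
      have h5 : 0 ≤ f (h - 1 - 1 - i) := (Real.exp_pos _).le
      simp only [hf] at *
      linarith
    · have := hsin (h - (i + 1)) (by linarith) (by linarith)
      have e : Real.pi * (h - (i + 1)) / h = Real.pi - Real.pi * (i + 1) / h := by
        field_simp
      rw [e, Real.sin_pi_sub] at this
      have h5 : 0 ≤ f i := (Real.exp_pos _).le
      simp only [hf, hcast] at *
      linarith
  refine (Finset.sum_le_sum hterm).trans (le_of_eq ?_)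
  rw [Finset.sum_add_distrib, Finset.sum_range_reflect, two_mul]

theorem sum_exp_neg_mul_sq_le_sqrt {a : ℝ} (ha : 0 < a) (m : ℕ) :
    ∑ i ∈ Finset.range m, Real.exp (-a * (i + 1 : ℝ) ^ 2) ≤ √(Real.pi / a) / 2 := by
  have hanti : AntitoneOn (fun x : ℝ => Real.exp (-a * x ^ 2)) (Set.Icc 0 (0 + (m : ℝ))) := by
    intro x hx y _ hxy
    refine Real.exp_le_exp.mpr ?_
    have : x ^ 2 ≤ y ^ 2 := pow_le_pow_left₀ hx.1 hxy 2
    nlinarith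
  have h1 := hanti.sum_le_integral
  have h2 : ∑ i ∈ Finset.range m, Real.exp (-a * (i + 1 : ℝ) ^ 2)
      = ∑ i ∈ Finset.range m, Real.exp (-a * (0 + ((i + 1 : ℕ) : ℝ)) ^ 2) := by simp
  rw [h2, ← integral_gaussian_Ioi a]
  refine h1.trans ?_
  rw [intervalIntegral.integral_of_le (by simp)]
  exact setIntegral_mono_set (integrable_exp_neg_mul_sq ha).integrableOn
    (ae_of_all _ fun x => (Real.exp_pos _).le) Set.Ioc_subset_Ioi_self.eventuallyLE

theorem sum_one_div_sq_le (m : ℕ) :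
    ∑ i ∈ Finset.range m, 1 / ((i : ℝ) + 1) ^ 2 ≤ 2 - 2 * (1 / ((m : ℝ) + 1)) := by
  induction m with
  | zero => norm_num
  | succ m ih =>
    rw [Finset.sum_range_succ]
    push_cast
    have h1 : 1 / ((m : ℝ) + 1) ^ 2 ≤ 2 * (1 / (m + 1)) - 2 * (1 / (m + 1 + 1)) := by
      rw [← mul_sub, div_sub_div _ _ (by positivity) (by positivity), ← mul_div_assoc,
        div_le_div_iff₀ (by positivity) (by positivity)]
      nlinarith [Nat.cast_nonneg (α := ℝ) m]
    linarith

/-- A polynomial substitute for the exponential decay when `a` is large: `x ≤ x^p ≤ p! a^(-p) exp (a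
x)` at `x = (i + 1)²` leaves the convergent sum of `1 / (i + 1)²`. -/
theorem sum_exp_neg_mul_sq_le_pow {a : ℝ} (ha : 0 < a) (m : ℕ) {p : ℕ} (hp : 1 ≤ p) :
    ∑ i ∈ Finset.range m, Real.exp (-a * (i + 1 : ℝ) ^ 2) ≤ 2 * p.factorial * (1 / a) ^ p := by
  have hterm : ∀ i ∈ Finset.range m, Real.exp (-a * (i + 1 : ℝ) ^ 2)
      ≤ p.factorial * (1 / a) ^ p * (1 / (i + 1 : ℝ) ^ 2) := by
    intro i _
    have h1 := Real.pow_le_factorial_mul_exp ha (y := (i + 1 : ℝ) ^ 2) (by positivity) p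
    have h2 : (i + 1 : ℝ) ^ 2 ≤ ((i + 1 : ℝ) ^ 2) ^ p :=
      le_self_pow₀ (one_le_pow₀ (by linarith [Nat.cast_nonneg (α := ℝ) i])) (by omega)
    rw [neg_mul, Real.exp_neg, mul_one_div, inv_le_comm₀ (Real.exp_pos _) (by positivity), inv_div,
      div_le_iff₀ (by positivity), one_div, mul_comm (Real.exp _)]
    exact h2.trans h1
  refine (Finset.sum_le_sum hterm).trans ?_
  rw [← Finset.mul_sum]
  have h3 := sum_one_div_sq_le m
  have h4 : (0 : ℝ) ≤ 1 / (m + 1) := by positivity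
  calc _ ≤ (p.factorial : ℝ) * (1 / a) ^ p * 2 := by gcongr; linarith
    _ = _ := by ring

theorem cycleTrace_div_le {n h : ℕ} (hn : n = 2 * h) (hh : 0 < h) {t N : ℕ} (ht : 1 ≤ t)
    (hN : t ≤ N) : cycleTrace h N / n ≤ 1 / √t := by
  have hh0 : (0 : ℝ) < h := by exact_mod_cast hh
  have ht0 : (0 : ℝ) < t := by exact_mod_cast ht
  have h1 := (cycleTrace_antitone h hN).trans (cycleTrace_le h t)
  have h2 := sum_exp_neg_mul_sq_le_sqrt (a := 2 * t / (h : ℝ) ^ 2) (by positivity) (h - 1)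
  have h3 : √(Real.pi / (2 * t / (h : ℝ) ^ 2)) ≤ 2 * h / √t := by
    apply Real.sqrt_le_iff.mpr
    refine ⟨by positivity, ?_⟩
    rw [div_pow, mul_pow, Real.sq_sqrt ht0.le, div_div_eq_mul_div,
      div_le_div_iff₀ (by positivity) ht0]
    nlinarith [Real.pi_lt_four, mul_pos (pow_pos hh0 2) ht0]
  have hn' : (n : ℝ) = 2 * h := by rw [hn]; push_cast; ring
  rw [hn', div_le_iff₀ (by positivity)]
  calc cycleTrace h N ≤ 2 * h / √t := by linarith
    _ = _ := by ring

theorem cycleTrace_div_le_pow {n h : ℕ} (hn : n = 2 * h) (hh : 0 < h) {t N : ℕ} (ht : 1 ≤ t)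
    (hN : t ≤ N) {p : ℕ} (hp : 1 ≤ p) :
    cycleTrace h N / n ≤ 4 * p.factorial / n * ((n : ℝ) ^ 2 / t) ^ p := by
  have hh0 : (0 : ℝ) < h := by exact_mod_cast hh
  have ht0 : (0 : ℝ) < t := by exact_mod_cast ht
  have hn' : (n : ℝ) = 2 * h := by rw [hn]; push_cast; ring
  have hn0 : (0 : ℝ) < n := by rw [hn']; positivity
  have h1 := (cycleTrace_antitone h hN).trans (cycleTrace_le h t)
  have h2 := sum_exp_neg_mul_sq_le_pow (a := 2 * t / (h : ℝ) ^ 2) (by positivity) (h - 1) hp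
  have h3 : (1 / (2 * t / (h : ℝ) ^ 2)) ^ p ≤ ((n : ℝ) ^ 2 / t) ^ p := by
    gcongr ?_ ^ p
    rw [one_div_div, hn', div_le_div_iff₀ (by positivity) ht0]
    nlinarith [mul_pos (pow_pos hh0 2) ht0]
  rw [div_mul_eq_mul_div]
  gcongr
  calc cycleTrace h N ≤ 2 * (2 * p.factorial * (1 / (2 * t / (h : ℝ) ^ 2)) ^ p) := by linarith
    _ ≤ 2 * (2 * p.factorial * ((n : ℝ) ^ 2 / t) ^ p) := by gcongr
    _ = _ := by ring

theorem exp_neg_le_cos_sq {x : ℝ} (hx0 : 0 ≤ x) (hx : x ≤ Real.pi / 3) :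
    Real.exp (-(4 * x ^ 2)) ≤ Real.cos x ^ 2 := by
  have h1 : 1 / 2 ≤ Real.cos x := by
    rw [← Real.cos_pi_div_three]
    exact Real.cos_le_cos_of_nonneg_of_le_pi hx0 (by linarith [Real.pi_pos]) hx
  have h2 : Real.sin x ^ 2 ≤ x ^ 2 := by
    exact pow_le_pow_left₀ (Real.sin_nonneg_of_nonneg_of_le_pi hx0 (by linarith [Real.pi_pos]))
      (Real.sin_le hx0) 2
  have h3 := Real.sin_sq_add_cos_sq x
  have h4 : 0 < Real.cos x ^ 2 := by positivity
  rw [Real.exp_neg, inv_le_comm₀ (Real.exp_pos _) h4]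
  refine le_trans ?_ (Real.add_one_le_exp _)
  rw [inv_le_iff_one_le_mul₀ h4]
  have h5 : 1 / 4 ≤ Real.cos x ^ 2 := by nlinarith
  nlinarith [mul_le_mul_of_nonneg_left h5 (sq_nonneg x)]

/-- About `n / √t` low frequencies each contribute at least the constant `c₀`. The restriction `6 ≤
n` is needed: for `n = 4` the only nontrivial term is a positive power of `cos (π/2) = 0`. -/
theorem exists_le_cycleTrace_div (A : ℝ) (hA : 0 < A) :
    ∃ c : ℝ, 0 < c ∧ ∀ {n h : ℕ}, n = 2 * h → 6 ≤ n → ∀ {t : ℕ}, 1 ≤ t →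
      (t : ℝ) ≤ A * (n : ℝ) ^ 2 → c * (1 / √t) ≤ cycleTrace h (4 * t - 2) / n := by
  set c₀ := Real.exp (-(32 * Real.pi ^ 2 * (A + 1))) with hc₀
  refine ⟨c₀ / 12, by positivity, ?_⟩
  intro n h hn h6 t ht htA
  have hh3 : 3 ≤ h := by omega
  have hh0 : (0 : ℝ) < h := by exact_mod_cast (show 0 < h by omega)
  have hn0 : (0 : ℝ) < n := by exact_mod_cast (show 0 < n by omega)
  have hn' : (n : ℝ) = 2 * h := by rw [hn]; push_cast; ring
  have ht1 : (1 : ℝ) ≤ t := by exact_mod_cast ht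
  have hs1 : 1 ≤ √(t : ℝ) := Real.one_le_sqrt.mpr ht1
  have hs2 : √(t : ℝ) ^ 2 = t := Real.sq_sqrt (by linarith)
  set s := √(t : ℝ) with hs
  set y := (n : ℝ) / (6 * s) with hy
  have hy0 : 0 < y := by positivity
  -- `K` is the number of frequencies counted: `⌊y⌋`, or `1` if `y < 1`. The bound `3 K ≤ h` keeps
  -- angles below `π/3`, where `exp_neg_le_cos_sq` applies, and the last bound keeps the exponents
  -- bounded; in the case `K = 1` it is the assumption `t ≤ A n²`.
  obtain ⟨K, hK1, hKy, hK6, hKt⟩ : ∃ K : ℕ, 1 ≤ K ∧ y / 2 ≤ K ∧ 3 * K ≤ h ∧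
      (t : ℝ) * (K : ℝ) ^ 2 ≤ (A + 1) * (n : ℝ) ^ 2 := by
    rcases le_or_gt 1 y with h1 | h1
    · refine ⟨⌊y⌋₊, Nat.le_floor (by simpa using h1), ?_, ?_, ?_⟩
      · have h2 := Nat.lt_floor_add_one y
        have h3 : (1 : ℝ) ≤ ⌊y⌋₊ := by
          exact_mod_cast Nat.le_floor (show ((1 : ℕ) : ℝ) ≤ y by simpa using h1)
        linarith
      · have h2 : (⌊y⌋₊ : ℝ) ≤ y := Nat.floor_le hy0.le
        have h3 : y ≤ n / 6 := by
          rw [hy]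
          gcongr
          linarith
        have h4 : (3 * ⌊y⌋₊ : ℝ) ≤ h := by linarith
        exact_mod_cast h4
      · have h2 : (⌊y⌋₊ : ℝ) ≤ y := Nat.floor_le hy0.le
        have h3 : (t : ℝ) * y ^ 2 = 1 / 36 * (n : ℝ) ^ 2 := by
          rw [hy, ← hs2]
          field_simp
          norm_num
        calc (t : ℝ) * (⌊y⌋₊ : ℝ) ^ 2 ≤ t * y ^ 2 := by gcongr
          _ = 1 / 36 * (n : ℝ) ^ 2 := h3
          _ ≤ _ := by gcongr; linarith
    · refine ⟨1, le_rfl, by push_cast; linarith, by omega, ?_⟩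
      have : 0 < (n : ℝ) ^ 2 := by positivity
      push_cast
      linarith
  have hKh : K ≤ h - 1 := by omega
  have hterm : ∀ i ∈ Finset.range K,
      c₀ ≤ |Real.cos (Real.pi * (i + 1 : ℝ) / h)| ^ (4 * t - 2) := by
    intro i hi
    have hiK : (i : ℝ) + 1 ≤ K := by exact_mod_cast Finset.mem_range.mp hi
    have hKh3 : (3 : ℝ) * K ≤ h := by exact_mod_cast hK6
    set x := Real.pi * (i + 1 : ℝ) / h with hx
    have hx0 : 0 ≤ x := by positivity
    have hx3 : x ≤ Real.pi / 3 := by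
      rw [hx, div_le_div_iff₀ hh0 (by norm_num)]
      nlinarith [Real.pi_pos]
    have e : 4 * t - 2 = 2 * (2 * t - 1) := by omega
    rw [e, pow_mul, sq_abs]
    calc c₀ ≤ Real.exp (-(4 * x ^ 2)) ^ (2 * t - 1) := by
          rw [← Real.exp_nat_mul, hc₀]
          refine Real.exp_le_exp.mpr ?_
          have h1 : ((2 * t - 1 : ℕ) : ℝ) ≤ 2 * t := by
            have : 2 * t - 1 ≤ 2 * t := by omega
            exact_mod_cast this
          have h2 : (t : ℝ) * x ^ 2 ≤ 4 * Real.pi ^ 2 * (A + 1) := by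
            have : (t : ℝ) * x ^ 2 = 4 * Real.pi ^ 2 * (t * (i + 1 : ℝ) ^ 2) / (n : ℝ) ^ 2 := by
              rw [hx, hn']
              field_simp
              norm_num
            have h4 : (t : ℝ) * (i + 1 : ℝ) ^ 2 ≤ (A + 1) * (n : ℝ) ^ 2 :=
              le_trans (by gcongr) hKt
            rw [this, div_le_iff₀ (by positivity), mul_assoc _ (A + 1)]
            gcongr
          have h3 : ((2 * t - 1 : ℕ) : ℝ) * (4 * x ^ 2) ≤ 2 * t * (4 * x ^ 2) := by gcongr
          linarith
      _ ≤ _ := by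
          gcongr
          exact exp_neg_le_cos_sq hx0 hx3
  have hsum : K * c₀ ≤ cycleTrace h (4 * t - 2) := by
    calc K * c₀ = ∑ i ∈ Finset.range K, c₀ := by simp
      _ ≤ ∑ i ∈ Finset.range K, |Real.cos (Real.pi * (i + 1 : ℝ) / h)| ^ (4 * t - 2) :=
          Finset.sum_le_sum hterm
      _ ≤ _ := Finset.sum_le_sum_of_subset_of_nonneg (Finset.range_subset_range.mpr hKh)
          fun _ _ _ => by positivity
  rw [le_div_iff₀ hn0]
  refine le_trans ?_ hsum
  calc c₀ / 12 * (1 / s) * n = y / 2 * c₀ := by rw [hy]; field_simp; ring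
    _ ≤ K * c₀ := by gcongr

end TraceBounds

/-! ### The torus round matrix as a Kronecker power. -/

section Tensor

variable {W : Type*} [Fintype W] [DecidableEq W] {r : ℕ}

/-- The Kronecker product of a family of matrices, as a homomorphism. -/
noncomputable def kroneckerHom : (Fin r → Matrix W W ℝ) →* Matrix (Fin r → W) (Fin r → W) ℝ where
  toFun Q := Matrix.of fun w u => ∏ i, Q i (w i) (u i)
  map_one' := by
    ext w u
    simp only [Matrix.of_apply, Pi.one_apply, Matrix.one_apply]
    by_cases h : w = u
    · simp [h]
    · rw [if_neg h]
      obtain ⟨i, hi⟩ := Function.ne_iff.mp h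
      exact Finset.prod_eq_zero (Finset.mem_univ i) (if_neg hi)
  map_mul' Q R := by
    ext w u
    simp only [Matrix.of_apply, Pi.mul_apply, Matrix.mul_apply]
    rw [Finset.prod_univ_sum, Fintype.piFinset_univ]
    exact Finset.sum_congr rfl fun x _ => Finset.prod_mul_distrib

omit [Fintype W] in
theorem Matching.matrix_apply (M : Matching W) (u v : W) :
    M.matrix u v = ((if v = u then 1 else 0) + (if v = M.partner u then 1 else 0)) / 2 := by
  rw [Matching.matrix, Matrix.of_apply]
  by_cases h : M.partner u = u
  · simp only [h, if_true]
    split_ifs <;> norm_num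
  · by_cases h1 : v = u
    · subst h1
      simp [h, Ne.symm h]
    · simp [h, h1]
      split_ifs <;> norm_num

omit [Fintype W] in
theorem ite_eq_update_eq_mul_prod (w u : Fin r → W) (i : Fin r) (c : W) :
    (if u = Function.update w i c then (1 : ℝ) else 0)
      = (if u i = c then 1 else 0) * ∏ j ∈ Finset.univ.erase i, if u j = w j then 1 else 0 := by
  by_cases h : u = Function.update w i c
  · subst h
    rw [if_pos rfl, Function.update_self, if_pos rfl, one_mul, Finset.prod_eq_one]
    intro j hj
    rw [Function.update_of_ne (Finset.ne_of_mem_erase hj), if_pos rfl]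
  · rw [if_neg h]
    obtain ⟨j, hj⟩ := Function.ne_iff.mp h
    by_cases hji : j = i
    · subst hji
      rw [Function.update_self] at hj
      rw [if_neg hj, zero_mul]
    · rw [Function.update_of_ne hji] at hj
      rw [Finset.prod_eq_zero (Finset.mem_erase.mpr ⟨hji, Finset.mem_univ j⟩) (if_neg hj),
        mul_zero]

theorem Matching.along_matrix (N : Matching W) (i : Fin r) :
    (N.along i).matrix = kroneckerHom (Pi.mulSingle i N.matrix) := by
  ext w u
  have h1 : (if u = w then (1 : ℝ) else 0)
      = (if u i = w i then 1 else 0) * ∏ j ∈ Finset.univ.erase i, if u j = w j then 1 else 0 := by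
    conv_lhs => rw [← Function.update_eq_self i w]
    exact ite_eq_update_eq_mul_prod w u i (w i)
  rw [Matching.matrix_apply, h1]
  change (_ + (if u = Function.update w i (N.partner (w i)) then (1 : ℝ) else 0)) / 2 = _
  rw [ite_eq_update_eq_mul_prod]
  change _ = ∏ j, (Pi.mulSingle i N.matrix : Fin r → Matrix W W ℝ) j (w j) (u j)
  rw [← Finset.mul_prod_erase _ _ (Finset.mem_univ i), Pi.mulSingle_eq_same, Matching.matrix_apply,
    ← add_mul, mul_div_right_comm]
  congr 1
  refine Finset.prod_congr rfl fun j hj => ?_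
  rw [Pi.mulSingle_eq_of_ne (Finset.ne_of_mem_erase hj), Matrix.one_apply]
  simp only [eq_comm]

theorem prod_ofFn_ite_eq {G : Type*} [Monoid G] (g : G) {r : ℕ} (k : Fin r) :
    (List.ofFn fun i => if i = k then g else 1).prod = g := by
  induction r with
  | zero => exact k.elim0
  | succ r ih =>
    rw [List.ofFn_succ, List.prod_cons]
    refine Fin.cases ?_ (fun k => ?_) k
    · simp
    · simp only [Fin.succ_inj, ih k]
      rw [if_neg (Fin.succ_ne_zero k).symm, one_mul]

/-- Project to coordinate `k`: every block of factors belonging to another coordinate becomes a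
product of ones, and the block of `k` gives the whole product of `f`. -/
theorem prod_ofFn_mulSingle {G : Type*} [Monoid G] (r d : ℕ) (f : Fin d → G) :
    (List.ofFn fun s : Fin (r * d) => (Pi.mulSingle s.divNat (f s.modNat) : Fin r → G)).prod
      = fun _ => (List.ofFn f).prod := by
  rw [List.ofFn_mul, List.prod_flatten, List.map_ofFn]
  ext k
  have h1 := map_list_prod (Pi.evalMonoidHom (fun _ : Fin r => G) k)
  simp only [Pi.evalMonoidHom_apply] at h1
  rw [h1, List.map_ofFn]
  refine Eq.trans ?_ (prod_ofFn_ite_eq (List.ofFn f).prod k)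
  congr 2
  ext i
  simp only [Function.comp_apply, Pi.evalMonoidHom_apply]
  rw [h1, List.map_ofFn]
  have h2 : ∀ j : Fin d, (⟨(i : ℕ) * d + j, by
      calc (i : ℕ) * d + j < i * d + d := by omega
        _ = (i + 1) * d := by ring
        _ ≤ r * d := Nat.mul_le_mul_right d i.isLt⟩ : Fin (r * d)).divNat = i ∧
      (⟨(i : ℕ) * d + j, by
      calc (i : ℕ) * d + j < i * d + d := by omega
        _ = (i + 1) * d := by ring
        _ ≤ r * d := Nat.mul_le_mul_right d i.isLt⟩ : Fin (r * d)).modNat = j := by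
    intro j
    have hd : 0 < d := j.pos
    constructor
    · ext
      simp only [Fin.divNat]
      rw [mul_comm, Nat.mul_add_div hd, Nat.div_eq_of_lt j.isLt, add_zero]
    · ext
      simp only [Fin.modNat]
      rw [mul_comm, Nat.mul_add_mod, Nat.mod_eq_of_lt j.isLt]
  by_cases hik : i = k
  · subst hik
    rw [if_pos rfl]
    congr 2
    ext j
    simp [(h2 j).1, (h2 j).2]
  · rw [if_neg hik]
    refine List.prod_eq_one fun x hx => ?_
    obtain ⟨j, rfl⟩ := (List.mem_ofFn' _ _).mp hx
    simp [(h2 j).1, Pi.mulSingle_eq_of_ne (Ne.symm hik)]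

theorem roundMatrix_torusCircuit_pow {r m : ℕ} [NeZero m] (hm : Even m) (t : ℕ)
    (w u : Fin r → ZMod m) :
    (roundMatrix (torusCircuit r m hm) ^ t) w u
      = ∏ i, (roundMatrix (cycleCircuit m hm) ^ t) (w i) (u i) := by
  have h : roundMatrix (torusCircuit r m hm)
      = kroneckerHom fun _ : Fin r => roundMatrix (cycleCircuit m hm) := by
    have h1 := prod_ofFn_mulSingle r 2 fun q => (cycleCircuit m hm q).matrix
    rw [roundMatrix, roundMatrix, ← h1, map_list_prod, List.map_ofFn]
    congr 2
    ext1 s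
    exact Matching.along_matrix _ _
  rw [h, ← map_pow]
  rfl

end Tensor

/-! ### Distance of torus columns from uniform. -/

section Torus

variable {r m : ℕ} [NeZero m]

theorem sum_roundMatrix_torusCircuit_pow_sub_sq [NeZero r] (hm : Even m) {h : ℕ} (hh : m = 2 * h)
    {t : ℕ} (ht : 1 ≤ t) (u : Fin r → ZMod m) :
    ∑ w, ((roundMatrix (torusCircuit r m hm) ^ t) w u - 1 / (m : ℝ) ^ r) ^ 2
      = (1 / (m : ℝ) + cycleTrace h (4 * t - 2) / m) ^ r - (1 / (m : ℝ)) ^ r := by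
  have h1 := sum_roundMatrix_pow_sub_sq (torusCircuit r m hm) t u
  have hc : (Fintype.card (Fin r → ZMod m) : ℝ) = (m : ℝ) ^ r := by simp [ZMod.card]
  rw [hc] at h1
  rw [h1, one_div_pow]
  congr 1
  simp_rw [roundMatrix_torusCircuit_pow, ← Finset.prod_pow]
  have h2 := Finset.prod_univ_sum (fun _ : Fin r => (Finset.univ : Finset (ZMod m)))
    (fun i a => (roundMatrix (cycleCircuit m hm) ^ t) a (u i) ^ 2)
  rw [Fintype.piFinset_univ] at h2
  rw [← h2]
  simp_rw [sum_roundMatrix_cycleCircuit_pow_sq hm hh ht]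
  simp

theorem sum_roundMatrix_cycleCircuit_pow_sub_sq (hm : Even m) {h : ℕ} (hh : m = 2 * h) {t : ℕ}
    (ht : 1 ≤ t) (u : ZMod m) :
    ∑ w, ((roundMatrix (cycleCircuit m hm) ^ t) w u - 1 / (m : ℝ)) ^ 2
      = cycleTrace h (4 * t - 2) / m := by
  have h1 := sum_roundMatrix_pow_sub_sq (cycleCircuit m hm) t u
  rw [ZMod.card, sum_roundMatrix_cycleCircuit_pow_sq hm hh ht] at h1
  rw [h1]
  ring

theorem pow_add_sub_pow_le {x E : ℝ} (hx : 0 ≤ x) (hE : 0 ≤ E) (r : ℕ) :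
    (x + E) ^ (r + 1) - x ^ (r + 1) ≤ (r + 1) * E * (x + E) ^ r := by
  induction r with
  | zero => simp
  | succ r ih =>
    have h1 : x ^ (r + 1) ≤ (x + E) ^ (r + 1) := by gcongr; linarith
    have h2 := mul_le_mul_of_nonneg_left ih (show 0 ≤ x + E by linarith)
    have h3 := mul_le_mul_of_nonneg_left h1 hE
    push_cast
    calc (x + E) ^ (r + 1 + 1) - x ^ (r + 1 + 1)
        = (x + E) * ((x + E) ^ (r + 1) - x ^ (r + 1)) + E * x ^ (r + 1) := by ring
      _ ≤ (x + E) * ((r + 1) * E * (x + E) ^ r) + E * (x + E) ^ (r + 1) := add_le_add h2 h3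
      _ = _ := by ring

/-- Let `E` be the normalized cosine sum. If `√t ≤ m`, then `1/m` and `E` are both at most `1/√t`.
If `√t > m`, the difference is at most `r E (1/m + E)^(r-1)`, and `E ≤ 1/√t` would leave too large a
bound `m^(-(r-1)) t^(-1/2)`. Instead the decay of order `r` gives `E ≤ (F/m) (m/√t)^r`, which yields
`t^(-r/2)`. -/
theorem exists_torus_excess_le (r : ℕ) (hr : 1 ≤ r) :
    ∃ C : ℝ, 0 < C ∧ ∀ {m h : ℕ}, m = 2 * h → 0 < h → ∀ {t : ℕ}, 1 ≤ t →
      (1 / (m : ℝ) + cycleTrace h (4 * t - 2) / m) ^ r - (1 / (m : ℝ)) ^ r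
        ≤ C * (1 / √t) ^ r := by
  obtain ⟨p, rfl⟩ : ∃ p, r = p + 1 := ⟨r - 1, by omega⟩
  set F : ℝ := 4 * (p + 1).factorial with hF
  have hF0 : 0 < F := by positivity
  refine ⟨2 ^ (p + 1) + (p + 1) * F * (1 + F) ^ p, by positivity, ?_⟩
  intro m h hm hh t ht
  have hm0 : (0 : ℝ) < m := by exact_mod_cast (show 0 < m by omega)
  have ht1 : (1 : ℝ) ≤ t := by exact_mod_cast ht
  have hs0 : 0 < √(t : ℝ) := Real.sqrt_pos.mpr (by linarith)
  have hs2 : √(t : ℝ) ^ 2 = t := Real.sq_sqrt (by linarith)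
  have hE0 : 0 ≤ cycleTrace h (4 * t - 2) / m := by
    have := cycleTrace_nonneg h (4 * t - 2)
    positivity
  have hE1 := cycleTrace_div_le hm hh ht (show t ≤ 4 * t - 2 by omega)
  have hE2 := cycleTrace_div_le_pow hm hh ht (show t ≤ 4 * t - 2 by omega)
    (show 1 ≤ p + 1 by omega)
  set E := cycleTrace h (4 * t - 2) / m
  set s := √(t : ℝ)
  rw [add_mul]
  have hsp : 0 < (1 / s) ^ (p + 1) := by positivity
  rcases le_or_gt s m with hsm | hsm
  · have h1 : 1 / (m : ℝ) ≤ 1 / s := by gcongr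
    have h2 : (1 / (m : ℝ) + E) ^ (p + 1) ≤ (2 * (1 / s)) ^ (p + 1) := by
      gcongr
      linarith
    rw [mul_pow] at h2
    have h3 : 0 ≤ (1 / (m : ℝ)) ^ (p + 1) := by positivity
    have h4 : 0 ≤ (p + 1) * F * (1 + F) ^ p * (1 / s) ^ (p + 1) := by positivity
    linarith
  · set y := (m : ℝ) / s with hy
    have hy0 : 0 < y := by positivity
    have hy1 : y ≤ 1 := by rw [hy, div_le_one hs0]; exact hsm.le
    have hyt : (m : ℝ) ^ 2 / t = y ^ 2 := by rw [← hs2, hy, div_pow]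
    have hmy : 1 / (m : ℝ) * y = 1 / s := by rw [hy]; field_simp
    rw [hyt, ← hF] at hE2
    have h3 : (y ^ 2) ^ (p + 1) ≤ y ^ (p + 1) := by
      rw [← pow_mul]
      exact pow_le_pow_of_le_one hy0.le hy1 (by omega)
    have hE3 : E ≤ F / m * y ^ (p + 1) := hE2.trans (by gcongr)
    have hE4 : E ≤ F / m :=
      hE3.trans (mul_le_of_le_one_right (by positivity) (pow_le_one₀ hy0.le hy1))
    refine (pow_add_sub_pow_le (by positivity) hE0 p).trans ?_
    have h5 : (p + 1) * E * (1 / (m : ℝ) + E) ^ p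
        ≤ (p + 1) * (F / m * y ^ (p + 1)) * (1 / (m : ℝ) + F / m) ^ p := by gcongr
    have h6 : (p + 1) * (F / m * y ^ (p + 1)) * (1 / (m : ℝ) + F / m) ^ p
        = (p + 1) * F * (1 + F) ^ p * (1 / s) ^ (p + 1) := by
      rw [← hmy, mul_pow, show 1 / (m : ℝ) + F / m = 1 / m * (1 + F) by ring, mul_pow, pow_succ]
      ring
    have h7 : 0 ≤ 2 ^ (p + 1) * (1 / s) ^ (p + 1) := by positivity
    linarith

theorem pow_le_add_pow_sub_pow {x E : ℝ} (hx : 0 ≤ x) (hE : 0 ≤ E) (hr : r ≠ 0) :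
    E ^ r ≤ (x + E) ^ r - x ^ r := by
  have := pow_add_pow_le hx hE hr
  linarith

theorem rpow_neg_div_two_eq (t r : ℕ) :
    (t : ℝ) ^ (-(r : ℝ) / 2) = (1 / √(t : ℝ)) ^ r := by
  rw [one_div, Real.sqrt_eq_rpow, ← Real.rpow_neg (Nat.cast_nonneg t),
    ← Real.rpow_mul_natCast (Nat.cast_nonneg t)]
  congr 1
  ring

theorem rpow_neg_div_four_sq (t r : ℕ) :
    ((t : ℝ) ^ (-(r : ℝ) / 4)) ^ 2 = (1 / √(t : ℝ)) ^ r := by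
  rw [← rpow_neg_div_two_eq, ← Real.rpow_mul_natCast (Nat.cast_nonneg t)]
  congr 1
  push_cast
  ring

/-- Two reasons for a threshold: `t^(-r/4)` must be small for anti-concentration, and `16 A < t ≤ A
m²` excludes side length `4`, where the lower bound on column norms fails (see
`six_le_of_even_of_le`). -/
theorem exists_rpow_neg_div_four_le (A α₀ : ℝ) (hα₀ : 0 < α₀) :
    ∃ t₀ : ℕ, ∀ t : ℕ, 1 ≤ t → t₀ ≤ t → ∀ r : ℕ, 1 ≤ r →
      (t : ℝ) ^ (-(r : ℝ) / 4) ≤ α₀ ∧ A * (4 : ℝ) ^ 2 < t := by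
  refine ⟨⌈(α₀ ^ 4)⁻¹⌉₊ + ⌈A * (4 : ℝ) ^ 2⌉₊ + 1, fun t ht ht₀ r hr => ⟨?_, ?_⟩⟩
  · have ht1 : (1 : ℝ) ≤ t := by exact_mod_cast ht
    have hr1 : (1 : ℝ) ≤ r := by exact_mod_cast hr
    have h1 : (α₀ ^ 4)⁻¹ ≤ t := by
      refine (Nat.le_ceil _).trans ?_
      exact_mod_cast (show ⌈(α₀ ^ 4)⁻¹⌉₊ ≤ t by omega)
    refine (Real.rpow_le_rpow_of_exponent_le ht1
      (show -(r : ℝ) / 4 ≤ -1 / 4 by linarith)).trans ?_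
    refine le_of_pow_le_pow_left₀ four_ne_zero hα₀.le ?_
    rw [← Real.rpow_mul_natCast (Nat.cast_nonneg t)]
    norm_num
    rw [Real.rpow_neg_one]
    exact inv_le_of_inv_le₀ (by positivity) h1
  · refine (Nat.le_ceil _).trans_lt ?_
    exact_mod_cast (show ⌈A * (4 : ℝ) ^ 2⌉₊ < t by omega)

theorem abs_roundMatrix_cycleCircuit_pow_le_of_le (hm : Even m) {A : ℝ} (hA : 0 < A) {t : ℕ}
    (ht : 1 ≤ t) (htA : (t : ℝ) ≤ A * (m : ℝ) ^ 2) (w u : ZMod m) :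
    |(roundMatrix (cycleCircuit m hm) ^ t) w u| ≤ (2 * √A + 2) * (1 / √t) ∧
      1 / (m : ℝ) ≤ √A * (1 / √t) := by
  obtain ⟨h, hh⟩ := hm.two_dvd
  have hm0 : (0 : ℝ) < m := by exact_mod_cast NeZero.pos m
  have ht1 : (1 : ℝ) ≤ t := by exact_mod_cast ht
  have hs0 : 0 < √(t : ℝ) := Real.sqrt_pos.mpr (by linarith)
  have h1 : √(t : ℝ) ≤ √A * m := by
    rw [← Real.sqrt_sq hm0.le, ← Real.sqrt_mul hA.le]
    exact Real.sqrt_le_sqrt htA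
  have h2 : 1 / (m : ℝ) ≤ √A * (1 / √t) := by
    rw [mul_one_div, div_le_div_iff₀ hm0 hs0]
    linarith
  refine ⟨(abs_roundMatrix_cycleCircuit_pow_le hm hh ht w u).trans ?_, h2⟩
  have h3 := cycleTrace_div_le hh (by have := NeZero.pos m; omega) ht
    (show t ≤ 2 * t - 1 by omega)
  calc 2 / (m : ℝ) * (1 + cycleTrace h (2 * t - 1))
      = 2 * (1 / m) + 2 * (cycleTrace h (2 * t - 1) / m) := by ring
    _ ≤ 2 * (√A * (1 / √t)) + 2 * (1 / √t) := by gcongr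
    _ = _ := by ring

/-- Supplies the flatness needed for the lower bound: single entries deviate by at most the order
`t^(-r/2)` of the squared column norm. The range `t ≤ A m²` enters because it makes `1/m` at most of
order `1/√t`. -/
theorem abs_roundMatrix_torusCircuit_pow_sub_le (hm : Even m) {A : ℝ} (hA : 0 < A) {t : ℕ}
    (ht : 1 ≤ t) (htA : (t : ℝ) ≤ A * (m : ℝ) ^ 2) (w u : Fin r → ZMod m) :
    |(roundMatrix (torusCircuit r m hm) ^ t) w u - 1 / (m : ℝ) ^ r|
      ≤ ((2 * √A + 2) ^ r + √A ^ r) * (1 / √t) ^ r := by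
  refine (abs_sub _ _).trans ?_
  rw [add_mul, ← mul_pow, ← mul_pow]
  refine add_le_add ?_ ?_
  · rw [roundMatrix_torusCircuit_pow, Finset.abs_prod]
    refine (Finset.prod_le_prod (fun _ _ => abs_nonneg _) fun i _ =>
      (abs_roundMatrix_cycleCircuit_pow_le_of_le hm hA ht htA (w i) (u i)).1).trans ?_
    simp
  · have hm0 : (0 : ℝ) < m := by exact_mod_cast NeZero.pos m
    rw [abs_of_pos (by positivity), ← one_div_pow]
    gcongr
    exact (abs_roundMatrix_cycleCircuit_pow_le_of_le hm hA ht htA 0 0).2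

end Torus

/-! ### Column estimates for both topologies and assembly of the theorem. -/

theorem cycle_upper : ∃ C : ℝ, 0 < C ∧ ∀ (n : ℕ) [NeZero n] (hn : Even n), 4 ≤ n →
    ∀ t : ℕ, 1 ≤ t → ∀ u : ZMod n,
      ∑ w, ((roundMatrix (cycleCircuit n hn) ^ t) w u - 1 / (n : ℝ)) ^ 2
        ≤ C * (1 / √(t : ℝ)) := by
  refine ⟨1, one_pos, fun n _ hn h4 t ht u => ?_⟩
  obtain ⟨h, hh⟩ := hn.two_dvd
  rw [sum_roundMatrix_cycleCircuit_pow_sub_sq hn hh ht, one_mul]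
  exact cycleTrace_div_le hh (by omega) ht (by omega)

theorem cycle_lower (A : ℝ) (hA : 0 < A) : ∃ c : ℝ, 0 < c ∧
    ∀ (n : ℕ) [NeZero n] (hn : Even n), 6 ≤ n → ∀ t : ℕ, 1 ≤ t → (t : ℝ) ≤ A * (n : ℝ) ^ 2 →
      ∀ u : ZMod n, c * (1 / √(t : ℝ))
        ≤ ∑ w, ((roundMatrix (cycleCircuit n hn) ^ t) w u - 1 / (n : ℝ)) ^ 2 := by
  obtain ⟨c, hc, hb⟩ := exists_le_cycleTrace_div A hA
  refine ⟨c, hc, fun n _ hn h6 t ht htA u => ?_⟩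
  obtain ⟨h, hh⟩ := hn.two_dvd
  rw [sum_roundMatrix_cycleCircuit_pow_sub_sq hn hh ht]
  exact hb hh h6 ht htA

theorem torus_upper (r : ℕ) [NeZero r] : ∃ C : ℝ, 0 < C ∧ ∀ (m : ℕ) [NeZero m] (hm : Even m),
    4 ≤ m → ∀ t : ℕ, 1 ≤ t → ∀ u : Fin r → ZMod m,
      ∑ w, ((roundMatrix (torusCircuit r m hm) ^ t) w u - 1 / (m : ℝ) ^ r) ^ 2
        ≤ C * (1 / √(t : ℝ)) ^ r := by
  obtain ⟨C, hC, hb⟩ := exists_torus_excess_le r (NeZero.pos r)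
  refine ⟨C, hC, fun m _ hm h4 t ht u => ?_⟩
  obtain ⟨h, hh⟩ := hm.two_dvd
  rw [sum_roundMatrix_torusCircuit_pow_sub_sq hm hh ht]
  exact hb hh (by omega) ht

theorem torus_lower (r : ℕ) [NeZero r] (A : ℝ) (hA : 0 < A) : ∃ c : ℝ, 0 < c ∧
    ∀ (m : ℕ) [NeZero m] (hm : Even m), 6 ≤ m → ∀ t : ℕ, 1 ≤ t → (t : ℝ) ≤ A * (m : ℝ) ^ 2 →
      ∀ u : Fin r → ZMod m, c * (1 / √(t : ℝ)) ^ r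
        ≤ ∑ w, ((roundMatrix (torusCircuit r m hm) ^ t) w u - 1 / (m : ℝ) ^ r) ^ 2 := by
  obtain ⟨c, hc, hb⟩ := exists_le_cycleTrace_div A hA
  refine ⟨c ^ r, by positivity, fun m _ hm h6 t ht htA u => ?_⟩
  obtain ⟨h, hh⟩ := hm.two_dvd
  have hE := hb hh h6 ht htA
  have hE0 : 0 ≤ c * (1 / √(t : ℝ)) := by positivity
  rw [sum_roundMatrix_torusCircuit_pow_sub_sq hm hh ht, ← mul_pow]
  -- Superadditivity of the `r`-th power: the excess over uniform is at least the `r`-th power of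
  -- the excess on the cycle.
  refine le_trans ?_ (pow_le_add_pow_sub_pow (r := r) (by positivity) (hE0.trans hE)
    (NeZero.ne r))
  gcongr

theorem six_le_of_even_of_le {m t : ℕ} (hm : Even m) (h4 : 4 ≤ m) {A : ℝ}
    (h1 : A * (4 : ℝ) ^ 2 < t) (h2 : (t : ℝ) ≤ A * (m : ℝ) ^ 2) : 6 ≤ m := by
  by_contra hlt
  obtain ⟨k, hk⟩ := hm
  have : m = 4 := by omega
  subst this
  push_cast at h2
  linarith

theorem mainTheorem5 :
    -- the cycle with `n` vertices
    ((∃ C : ℝ, 0 < C ∧ ∀ (n : ℕ) [NeZero n] (hn : Even n), 4 ≤ n → ∀ t : ℕ, 1 ≤ t → ∀ u : ZMod n,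
        ∑ w, ((roundMatrix (cycleCircuit n hn) ^ t) w u - 1 / (n : ℝ)) ^ 2
          ≤ C * (t : ℝ) ^ (-(1 / 2) : ℝ)) ∧
      (∀ A : ℝ, 0 < A → ∃ c : ℝ, 0 < c ∧
        ∀ (n : ℕ) [NeZero n] (hn : Even n), 6 ≤ n → ∀ t : ℕ, 1 ≤ t → (t : ℝ) ≤ A * (n : ℝ) ^ 2 →
        ∀ u : ZMod n,
          c * (t : ℝ) ^ (-(1 / 2) : ℝ)
            ≤ ∑ w, ((roundMatrix (cycleCircuit n hn) ^ t) w u - 1 / (n : ℝ)) ^ 2) ∧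
      (∀ B κ : ℝ, 0 < B → 0 < κ → ∃ C K : ℝ, 0 < C ∧ 0 < K ∧
        ∀ (n : ℕ) [NeZero n] (hn : Even n), 4 ≤ n →
        ∀ (D : Measure ℕ) [IsProbabilityMeasure D], IsExpConcentrated D B κ →
        ∀ t : ℕ, 1 ≤ t →
          1 - K / (n : ℝ) ≤ (averageCaseLaw (cycleCircuit n hn) D t).real
            {x | (disc x : ℝ) ≤
              C * ((t : ℝ) ^ (-(1 / 4) : ℝ) * distStd D * Real.log n ^ (3 / 2 : ℝ)
                + √(Real.log n))}) ∧
      (∀ B κ A : ℝ, 0 < B → 0 < κ → 0 < A → ∃ (c C : ℝ) (t₀ : ℕ), 0 < c ∧ 0 < C ∧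
        ∀ (n : ℕ) [NeZero n] (hn : Even n), 4 ≤ n →
        ∀ (D : Measure ℕ) [IsProbabilityMeasure D], IsExpConcentrated D B κ →
        ∀ t : ℕ, 1 ≤ t → t₀ ≤ t → (t : ℝ) ≤ A * (n : ℝ) ^ 2 →
          1 / 16 ≤ (averageCaseLaw (cycleCircuit n hn) D t).real
            {x | c * ((t : ℝ) ^ (-(1 / 4) : ℝ) * distStd D / √(Real.log (max (distStd D) 2)))
              - C * √(Real.log n) ≤ (disc x : ℝ)})) ∧
    -- the `r`-dimensional torus with side length `m` and `m ^ r` vertices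
    (∀ (r : ℕ) [NeZero r],
      (∃ C : ℝ, 0 < C ∧ ∀ (m : ℕ) [NeZero m] (hm : Even m), 4 ≤ m → ∀ t : ℕ, 1 ≤ t →
        ∀ u : Fin r → ZMod m,
          ∑ w, ((roundMatrix (torusCircuit r m hm) ^ t) w u - 1 / (m : ℝ) ^ r) ^ 2
            ≤ C * (t : ℝ) ^ (-(r : ℝ) / 2)) ∧
      (∀ A : ℝ, 0 < A → ∃ c : ℝ, 0 < c ∧
        ∀ (m : ℕ) [NeZero m] (hm : Even m), 6 ≤ m → ∀ t : ℕ, 1 ≤ t → (t : ℝ) ≤ A * (m : ℝ) ^ 2 →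
        ∀ u : Fin r → ZMod m,
          c * (t : ℝ) ^ (-(r : ℝ) / 2)
            ≤ ∑ w, ((roundMatrix (torusCircuit r m hm) ^ t) w u - 1 / (m : ℝ) ^ r) ^ 2) ∧
      (∀ B κ : ℝ, 0 < B → 0 < κ → ∃ C K : ℝ, 0 < C ∧ 0 < K ∧
        ∀ (m : ℕ) [NeZero m] (hm : Even m), 4 ≤ m →
        ∀ (D : Measure ℕ) [IsProbabilityMeasure D], IsExpConcentrated D B κ →
        ∀ t : ℕ, 1 ≤ t →
          1 - K / (m : ℝ) ^ r ≤ (averageCaseLaw (torusCircuit r m hm) D t).real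
            {x | (disc x : ℝ) ≤
              C * ((t : ℝ) ^ (-(r : ℝ) / 4) * distStd D * Real.log ((m : ℝ) ^ r) ^ (3 / 2 : ℝ)
                + √(Real.log ((m : ℝ) ^ r)))}) ∧
      (∀ B κ A : ℝ, 0 < B → 0 < κ → 0 < A → ∃ (c C : ℝ) (t₀ : ℕ), 0 < c ∧ 0 < C ∧
        ∀ (m : ℕ) [NeZero m] (hm : Even m), 4 ≤ m →
        ∀ (D : Measure ℕ) [IsProbabilityMeasure D], IsExpConcentrated D B κ →
        ∀ t : ℕ, 1 ≤ t → t₀ ≤ t → (t : ℝ) ≤ A * (m : ℝ) ^ 2 →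
          1 / 16 ≤ (averageCaseLaw (torusCircuit r m hm) D t).real
            {x | c * ((t : ℝ) ^ (-(r : ℝ) / 4) * distStd D / √(Real.log (max (distStd D) 2)))
              - C * √(Real.log ((m : ℝ) ^ r)) ≤ (disc x : ℝ)})) := by
  have hcyc : ∀ t : ℕ, (t : ℝ) ^ (-(1 / 2) : ℝ) = 1 / √(t : ℝ) := by
    intro t
    have := rpow_neg_div_two_eq t 1
    rw [pow_one] at this
    rw [← this]
    norm_num
  have hcyc4 : (-(1 / 4) : ℝ) = -((1 : ℕ) : ℝ) / 4 := by norm_num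
  have hpos : ∀ t : ℕ, 1 ≤ t → ∀ y : ℝ, 0 < (t : ℝ) ^ y := fun t ht y =>
    Real.rpow_pos_of_pos (by exact_mod_cast ht) y
  refine ⟨⟨?_, ?_, ?_, ?_⟩, fun r _ => ⟨?_, ?_, ?_, ?_⟩⟩
  · simp_rw [hcyc]
    exact cycle_upper
  · simp_rw [hcyc]
    exact cycle_lower
  · intro B κ hB hκ
    obtain ⟨C₁, hC₁, hb⟩ := cycle_upper
    obtain ⟨C, K, hC, hK, hmain⟩ := exists_averageCaseLaw_disc_le B κ C₁ hB hκ hC₁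
    refine ⟨C, K, hC, hK, fun n _ hn h4 D _ hD t ht => ?_⟩
    -- The general bounds are applied with `α = t^(-1/4)`, so that `α²` is the order `1/√t` of the
    -- squared column norm; the torus uses `t^(-r/4)` likewise.
    have h := hmain (cycleCircuit n hn) t ((t : ℝ) ^ (-(1 / 4) : ℝ))
      (by rw [ZMod.card]; exact_mod_cast h4) (hpos t ht _) (fun u => by
        rw [hcyc4, rpow_neg_div_four_sq, pow_one, ZMod.card]
        exact hb n hn h4 t ht u) D hD
    rw [ZMod.card] at h
    exact h
  · intro B κ A hB hκ hA
    obtain ⟨c₁, hc₁, hb⟩ := cycle_lower A hA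
    -- The entry constant adds the bound `2√A + 2` for a matrix entry and `√A` for the uniform value
    -- `1/n`, both relative to `1/√t`.
    obtain ⟨c, C, α₀, hc, hC, hα₀, hmain⟩ := exists_le_averageCaseLaw_disc B κ c₁
      (2 * √A + 2 + √A) hB hκ hc₁ (by positivity)
    obtain ⟨t₀, ht₀⟩ := exists_rpow_neg_div_four_le A α₀ hα₀
    refine ⟨c, C, t₀, hc, hC, fun n _ hn h4 D _ hD t ht htt htA => ?_⟩
    obtain ⟨hα, htA'⟩ := ht₀ t ht htt 1 le_rfl
    have h6 := six_le_of_even_of_le hn h4 htA' htA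
    have h := hmain (cycleCircuit n hn) t ((t : ℝ) ^ (-(1 / 4) : ℝ)) 0
      (by rw [ZMod.card]; exact_mod_cast h4) (hpos t ht _) (by rw [hcyc4]; exact hα) (by
        rw [hcyc4, rpow_neg_div_four_sq, pow_one, ZMod.card]
        exact hb n hn h6 t ht htA 0) (fun w => by
        rw [hcyc4, rpow_neg_div_four_sq, pow_one, ZMod.card, add_mul]
        obtain ⟨h1, h2⟩ := abs_roundMatrix_cycleCircuit_pow_le_of_le hn hA ht htA w 0
        refine (abs_sub _ _).trans (add_le_add h1 ?_)
        rw [abs_of_nonneg (by positivity)]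
        exact h2) D hD
    rw [ZMod.card] at h
    exact h
  · simp_rw [rpow_neg_div_two_eq]
    exact torus_upper r
  · simp_rw [rpow_neg_div_two_eq]
    exact torus_lower r
  · intro B κ hB hκ
    obtain ⟨C₁, hC₁, hb⟩ := torus_upper r
    obtain ⟨C, K, hC, hK, hmain⟩ := exists_averageCaseLaw_disc_le B κ C₁ hB hκ hC₁
    refine ⟨C, K, hC, hK, fun m _ hm h4 D _ hD t ht => ?_⟩
    have hcard : (Fintype.card (Fin r → ZMod m) : ℝ) = (m : ℝ) ^ r := by simp [ZMod.card]
    have hcard4 : (4 : ℝ) ≤ (m : ℝ) ^ r := by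
      exact_mod_cast h4.trans (Nat.le_self_pow (NeZero.ne r) m)
    have h := hmain (torusCircuit r m hm) t ((t : ℝ) ^ (-(r : ℝ) / 4))
      (by rw [hcard]; exact hcard4) (hpos t ht _) (fun u => by
        rw [rpow_neg_div_four_sq, hcard]
        exact hb m hm h4 t ht u) D hD
    rw [hcard] at h
    exact h
  · intro B κ A hB hκ hA
    obtain ⟨c₁, hc₁, hb⟩ := torus_lower r A hA
    obtain ⟨c, C, α₀, hc, hC, hα₀, hmain⟩ := exists_le_averageCaseLaw_disc B κ c₁
      ((2 * √A + 2) ^ r + √A ^ r) hB hκ hc₁ (by positivity)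
    obtain ⟨t₀, ht₀⟩ := exists_rpow_neg_div_four_le A α₀ hα₀
    refine ⟨c, C, t₀, hc, hC, fun m _ hm h4 D _ hD t ht htt htA => ?_⟩
    obtain ⟨hα, htA'⟩ := ht₀ t ht htt r (NeZero.pos r)
    have h6 := six_le_of_even_of_le hm h4 htA' htA
    have hcard : (Fintype.card (Fin r → ZMod m) : ℝ) = (m : ℝ) ^ r := by simp [ZMod.card]
    have hcard4 : (4 : ℝ) ≤ (m : ℝ) ^ r := by
      exact_mod_cast h4.trans (Nat.le_self_pow (NeZero.ne r) m)
    have h := hmain (torusCircuit r m hm) t ((t : ℝ) ^ (-(r : ℝ) / 4)) 0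
      (by rw [hcard]; exact hcard4) (hpos t ht _) hα (by
        rw [rpow_neg_div_four_sq, hcard]
        exact hb m hm h6 t ht htA 0) (fun w => by
        rw [rpow_neg_div_four_sq, hcard]
        exact abs_roundMatrix_torusCircuit_pow_sub_le hm hA ht htA w 0) D hD
    rw [hcard] at h
    exact h
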